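/- Let $\mathbb{K}$ be an algebraically closed field of characteristic zero, let $$X = V(z_1z_3 - z_2z_4) \subset \mathbb{K}^4,$$ and let the two-dimensional torus $T = \mathbb{K}^*\times\mathbb{K}^*$ act on $X$ by $$t\cdot x = (t_1^2x_1,\; t_1t_2^2x_2,\; t_1t_2x_3,\; t_1^2t_2^{-1}x_4).$$ Let $U = X_{z_2z_3}\cup X_{z_1z_4}\subset X$ be the $T$-invariant open set of all points with $x_2x_3\neq 0$ or $x_1x_4\neq 0$. Then: (i) $U$ has a geometric quotient $U\to U/T$ with $U/T\cong\mathbb{P}_1$. Here a geometric quotient is an affine $T$-invariant morphism $p\colon U\to Y$ such that the canonical map $\mathcal{O}_Y\to p_*(\mathcal{O}_U)^T$ is an isomorphism and the fibres of $p$ over closed points are precisely the $T$-orbits. (ii) There is no $T$-linearized line bundle $L$ on $X$ such that $U$ is the set $X^{ss}(L)$ of semistable points of $L$ in the sense of Mumford. Here a $T$-linearized line bundle is a line bundle with a $T$-action on its total space that makes the projection equivariant and is linear on the fibres, and a point $x\in X$ is semistable with respect to $L$ if for some $n>0$ there is a $T$-invariant section $s$ of $L^{\otimes n}$ (with the induced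 linearization) such that $X_s=\{s\ne 0\}$ is affine and contains $x$. -/

import Mathlib

universe u

open CategoryTheory MonoidalCategory CartesianMonoidalCategory AlgebraicGeometry MonObj
open scoped TensorProduct

noncomputable section

namespace ConeGIT

/-! ### Schemes over a field -/

/-- Schemes over the field `K`. The monoidal structure on this category is the fibre product over
`Spec K`, and its unit `𝟙_ (KScheme K)` is `Spec K`. A `K`-point of `X` is a morphism
`𝟙_ (KScheme K) ⟶ X`. -/
abbrev KScheme (K : Type u) [Field K] : Type (u + 1) := Over (Spec (CommRingCat.of K))

/-- The affine `K`-scheme `Spec A` of a commutative `K`-algebra `A`. If `A` is a bialgebra, Mathlib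
makes `Spec A` a monoid object. -/
abbrev affineScheme (K : Type u) [Field K] (A : Type u) [CommRing A] [Algebra K A] : KScheme K :=
  (Spec (CommRingCat.of A)).asOver (Spec (CommRingCat.of K))

/-- The morphism of affine `K`-schemes given by a homomorphism of `K`-algebras. -/
def affineMap (K : Type u) [Field K] {A B : Type u} [CommRing A] [CommRing B] [Algebra K A]
    [Algebra K B] (φ : A →ₐ[K] B) : affineScheme K B ⟶ affineScheme K A :=
  (Spec.map (CommRingCat.ofHom φ.toRingHom)).asOver (Spec (CommRingCat.of K))

/-- The canonical (iso)morphism `Spec A × Spec B ⟶ Spec (A ⊗ B)`. -/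
def prodToSpec (K : Type u) [Field K] (A B : Type u) [CommRing A] [CommRing B] [Algebra K A]
    [Algebra K B] : affineScheme K A ⊗ affineScheme K B ⟶ affineScheme K (A ⊗[K] B) :=
  Over.homMk (pullbackSpecIso K A B).hom (pullbackSpecIso_hom_base K A B)

/-- The affine line with its multiplicative monoid structure: the spectrum of the monoid algebra
`K[ℕ]`, that is, of the polynomial ring in a coordinate `x` with comultiplication
`x ↦ x ⊗ x`. -/
abbrev affineLine (K : Type u) [Field K] : KScheme K := affineScheme K (AddMonoidAlgebra K ℕ)

/-- The origin of the affine line. -/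
def origin (K : Type u) [Field K] : 𝟙_ (KScheme K) ⟶ affineLine K :=
  Over.homMk (Spec.map (CommRingCat.ofHom
    (AddMonoidAlgebra.lift K K ℕ (powersHom K (0 : K))).toRingHom)) (by
      have h : CommRingCat.ofHom (algebraMap K (AddMonoidAlgebra K ℕ)) ≫ CommRingCat.ofHom
          (AddMonoidAlgebra.lift K K ℕ (powersHom K (0 : K))).toRingHom = 𝟙 _ := by
        ext r
        exact (AddMonoidAlgebra.lift K K ℕ (powersHom K (0 : K))).commutes r
      refine (Spec.map_comp _ _).symm.trans ?_
      rw [h]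
      exact Spec.map_id _)

/-- The two-dimensional torus `𝔾ₘ × 𝔾ₘ`: the spectrum of the group algebra `K[ℤ × ℤ]`; the
coordinates `t₁`, `t₂` are the basis elements at `(1, 0)` and `(0, 1)`. -/
abbrev torus (K : Type u) [Field K] : KScheme K := affineScheme K (AddMonoidAlgebra K (ℤ × ℤ))

section
attribute [local instance] MvPolynomial.gradedAlgebra

/-- The projective line `Proj K[x₀, x₁]` over `K`. -/
def projectiveLine (K : Type u) [Field K] : KScheme K :=
  Over.mk (Proj.toSpecZero (MvPolynomial.homogeneousSubmodule (Fin 2) K) ≫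
    Spec.map (CommRingCat.ofHom
      (algebraMap K (MvPolynomial.homogeneousSubmodule (Fin 2) K 0))))

end

section General

variable {K : Type u} [Field K]

/-- An open subset of a `K`-scheme as a `K`-scheme. -/
def openSub (X : KScheme K) (V : X.left.Opens) : KScheme K := Over.mk (V.ι ≫ X.hom)

/-- The inclusion of an open subscheme. -/
def openIncl (X : KScheme K) (V : X.left.Opens) : openSub X V ⟶ X := Over.homMk V.ι

/-- The action morphism `(g, x) ↦ g • x`. -/
abbrev act (G X : KScheme K) [MonObj G] [ModObj G X] : G ⊗ X ⟶ X := γ[G, X]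

/-! ### Good and geometric quotients -/

/-- The function `f` on the open set `W` of the `G`-scheme `X` is `G`-invariant: its pullbacks along
`(g, x) ↦ g • x` and `(g, x) ↦ x` agree (wherever both are defined, which is everywhere on `G × W`
if `W` is `G`-invariant). -/
def IsInvariantFunction (G X : KScheme K) [MonObj G] [ModObj G X] {W : X.left.Opens}
    (f : Γ(X.left, W)) : Prop :=
  (act G X).left.app W f |_ (((act G X).left ⁻¹ᵁ W) ⊓ ((snd G X).left ⁻¹ᵁ W)) =
    (snd G X).left.app W f |_ (((act G X).left ⁻¹ᵁ W) ⊓ ((snd G X).left ⁻¹ᵁ W))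

/-- A good quotient: an affine `G`-invariant morphism `p : X ⟶ Y` such that the canonical map from
`𝒪_Y` to the sheaf of invariants `(p_* 𝒪_X)^G` is an isomorphism. -/
structure IsGoodQuotient (G : KScheme K) [MonObj G] {X Y : KScheme K} [ModObj G X]
    (p : X ⟶ Y) : Prop where
  isAffineHom : IsAffineHom p.left
  invariant : act G X ≫ p = snd G X ≫ p
  injective (V : Y.left.Opens) : Function.Injective (p.left.app V)
  mem_range_iff (V : Y.left.Opens) (f : Γ(X.left, p.left ⁻¹ᵁ V)) :
    f ∈ Set.range (p.left.app V) ↔ IsInvariantFunction G X f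

/-- A geometric quotient: a good quotient whose fibres (over `K`-points) are precisely the
`G`-orbits. -/
structure IsGeometricQuotient (G : KScheme K) [MonObj G] {X Y : KScheme K} [ModObj G X]
    (p : X ⟶ Y) : Prop extends IsGoodQuotient G p where
  fibre_eq_orbit (y : 𝟙_ (KScheme K) ⟶ Y) : ∃ x : 𝟙_ (KScheme K) ⟶ X,
    ∀ x' : 𝟙_ (KScheme K) ⟶ X,
      x' ≫ p = y ↔ ∃ g : 𝟙_ (KScheme K) ⟶ G, x' = lift g x ≫ act G X

/-! ### Linearized line bundles and semistable points -/

/-- A (geometric) line bundle on `X`: a scheme over `X` with a scalar multiplication by the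
multiplicative monoid of the affine line that over the members of an open cover of `X` is isomorphic
to the trivial bundle `𝔸¹ × V`. An isomorphism between trivial bundles that respects scalar
multiplication is multiplication by an invertible function, so that the linear structure of the
fibres is determined by the scalar multiplication. -/
structure LineBundle (X : KScheme K) where
  /-- The total space. -/
  total : KScheme K
  /-- The bundle projection. -/
  proj : total ⟶ X
  /-- The scalar multiplication. -/
  [scalar : ModObj (affineLine K) total]
  scalar_proj : act (affineLine K) total ≫ proj = snd (affineLine K) total ≫ proj
  locally_trivial (x : X.left) : ∃ V : X.left.Opens, x ∈ V ∧
    ∃ φ : affineLine K ⊗ openSub X V ⟶ total,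
      IsPullback φ (snd (affineLine K) (openSub X V)) proj (openIncl X V) ∧
      affineLine K ◁ φ ≫ act (affineLine K) total =
        (α_ (affineLine K) (affineLine K) (openSub X V)).inv ≫
          μ[affineLine K] ▷ openSub X V ≫ φ

attribute [instance] LineBundle.scalar

/-- The zero section of a line bundle, as a subset of the total space: the image of `e ↦ 0 • e`. -/
def LineBundle.zeroLocus {X : KScheme K} (L : LineBundle X) : Set L.total.left :=
  Set.range (lift (toUnit L.total ≫ origin K) (𝟙 L.total) ≫ act (affineLine K) L.total).left

/-- A `G`-linearized line bundle on the `G`-scheme `X`: a line bundle with an action of `G` on the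
total space such that the projection is equivariant and the induced maps on the fibres are linear,
that is, compatible with scalar multiplication. -/
structure LinearizedLineBundle (G : KScheme K) [MonObj G] (X : KScheme K) [ModObj G X]
    extends LineBundle X where
  /-- The action on the total space. -/
  [action : ModObj G total]
  proj_equivariant : act G total ≫ proj = G ◁ proj ≫ act G X
  /-- `c • (g • e) = g • (c • e)`. -/
  linear : affineLine K ◁ act G total ≫ act (affineLine K) total =
    lift (snd (affineLine K) (G ⊗ total) ≫ fst G total)
      (lift (fst (affineLine K) (G ⊗ total)) (snd (affineLine K) (G ⊗ total) ≫ snd G total)) ≫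
      G ◁ act (affineLine K) total ≫ act G total

attribute [instance] LinearizedLineBundle.action

namespace LinearizedLineBundle

variable {G : KScheme K} [MonObj G] {X : KScheme K} [ModObj G X]

/-- For `n > 0`: `ν` exhibits the linearized line bundle `M` as the `n`-th tensor power of `L`,
where `ν` is the map `e ↦ e ⊗ ⋯ ⊗ e`. It is a morphism over `X` that is equivariant, homogeneous of
degree `n` and nonzero outside the zero section. In local trivializations such a map is
`(c, x) ↦ (u(x) cⁿ, x)` with an invertible function `u`, so `e ⊗ ⋯ ⊗ e ↦ ν(e)` defines an
isomorphism of linearized line bundles from the `n`-th tensor power of `L` to `M`. -/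
structure IsPower (n : ℕ) (L M : LinearizedLineBundle G X) (ν : L.total ⟶ M.total) : Prop where
  comp_proj : ν ≫ M.proj = L.proj
  equivariant : act G L.total ≫ ν = G ◁ ν ≫ act G M.total
  homogeneous : act (affineLine K) L.total ≫ ν =
    ((𝟙 (affineLine K) : affineLine K ⟶ affineLine K) ^ n ⊗ₘ ν) ≫ act (affineLine K) M.total
  nonvanishing (e : L.total.left) : ν.left e ∈ M.zeroLocus → e ∈ L.zeroLocus

/-- A `G`-invariant section of a linearized line bundle. -/
structure IsInvariantSection (M : LinearizedLineBundle G X) (s : X ⟶ M.total) : Prop where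
  section_proj : s ≫ M.proj = 𝟙 X
  equivariant : act G X ≫ s = G ◁ s ≫ act G M.total

/-- The set `X_s` of all points where the section `s` does not vanish. -/
def nonvanishingLocus (M : LinearizedLineBundle G X) (s : X ⟶ M.total) : Set X.left :=
  {x | s.left x ∉ M.zeroLocus}

/-- The set of semistable points of a linearized line bundle in the sense of Mumford: the point `x`
is semistable if some positive power of the bundle has an invariant section `s` such that `X_s` is
an affine neighbourhood of `x`. -/
def semistableLocus (L : LinearizedLineBundle G X) : Set X.left :=
  {x | ∃ (n : ℕ) (M : LinearizedLineBundle G X) (ν : L.total ⟶ M.total) (s : X ⟶ M.total)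
    (V : X.left.Opens), 0 < n ∧ L.IsPower n M ν ∧ M.IsInvariantSection s ∧
      (V : Set X.left) = M.nonvanishingLocus s ∧ IsAffineOpen V ∧ x ∈ V}

end LinearizedLineBundle

end General

/-! ### The quadric cone with its torus action -/

/-- The ideal generated by `z₁z₃ - z₂z₄`; the coordinate `zᵢ` has index `i - 1`. -/
abbrev coneIdeal (K : Type u) [Field K] : Ideal (MvPolynomial (Fin 4) K) :=
  Ideal.span {MvPolynomial.X 0 * MvPolynomial.X 2 - MvPolynomial.X 1 * MvPolynomial.X 3}

/-- The coordinate ring of the quadric cone. -/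
abbrev coneRing (K : Type u) [Field K] : Type u := MvPolynomial (Fin 4) K ⧸ coneIdeal K

/-- The coordinate functions on the cone. -/
def coord (K : Type u) [Field K] (i : Fin 4) : coneRing K :=
  Ideal.Quotient.mk (coneIdeal K) (MvPolynomial.X i)

/-- The quadric cone `X = V(z₁z₃ - z₂z₄)` in `K⁴`. -/
abbrev cone (K : Type u) [Field K] : KScheme K := affineScheme K (coneRing K)

/-- The open subset `X_{z₂z₃} ∪ X_{z₁z₄}` of the cone. -/
def coneOpen (K : Type u) [Field K] : (cone K).left.Opens :=
  (PrimeSpectrum.basicOpen (coord K 1 * coord K 2) ⊔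
    PrimeSpectrum.basicOpen (coord K 0 * coord K 3) :
      TopologicalSpace.Opens (PrimeSpectrum (coneRing K)))

/-- The exponents of the characters by which the torus acts on the coordinates. -/
def weight : Fin 4 → ℤ × ℤ := ![(2, 0), (1, 2), (1, 1), (2, -1)]

/-- The comorphism `zᵢ ↦ χᵢ ⊗ zᵢ` of the action
`t • x = (t₁² x₁, t₁ t₂² x₂, t₁ t₂ x₃, t₁² t₂⁻¹ x₄)`. -/
def coaction (K : Type u) [Field K] :
    coneRing K →ₐ[K] AddMonoidAlgebra K (ℤ × ℤ) ⊗[K] coneRing K :=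
  Ideal.Quotient.liftₐ (coneIdeal K)
    (MvPolynomial.aeval fun i => AddMonoidAlgebra.single (weight i) (1 : K) ⊗ₜ[K] coord K i) (by
      intro a ha
      have h : coneIdeal K ≤ RingHom.ker (MvPolynomial.aeval (R := K) fun i : Fin 4 =>
          AddMonoidAlgebra.single (weight i) (1 : K) ⊗ₜ[K] coord K i) := by
        rw [Ideal.span_le, Set.singleton_subset_iff, SetLike.mem_coe, RingHom.mem_ker]
        have e : coord K 0 * coord K 2 = coord K 1 * coord K 3 := by
          rw [coord, coord, coord, coord, ← map_mul, ← map_mul, Ideal.Quotient.eq]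
          exact Ideal.subset_span rfl
        simp [AddMonoidAlgebra.single_mul_single, weight, e]
      exact h ha)

/-- The action morphism of the torus on the cone. -/
def torusAct (K : Type u) [Field K] : torus K ⊗ cone K ⟶ cone K :=
  prodToSpec K _ _ ≫ affineMap K (coaction K)

section

variable (K : Type u) [Field K]

lemma prodToSpec_fst (A B : Type u) [CommRing A] [CommRing B] [Algebra K A] [Algebra K B] :
    prodToSpec K A B ≫ affineMap K Algebra.TensorProduct.includeLeft = fst _ _ := by
  ext1
  exact pullbackSpecIso_hom_fst K A B

lemma prodToSpec_snd (A B : Type u) [CommRing A] [CommRing B] [Algebra K A] [Algebra K B] :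
    prodToSpec K A B ≫ affineMap K Algebra.TensorProduct.includeRight = snd _ _ := by
  ext1
  exact pullbackSpecIso_hom_snd K A B

/-- Pullback of functions along a morphism to an affine scheme. -/
def comor {A : Type u} [CommRing A] [Algebra K A] {W : KScheme K} (f : W ⟶ affineScheme K A) :
    A →+* Γ(W.left, ⊤) := ((Scheme.ΓSpecIso (.of A)).inv ≫ f.left.appTop).hom

lemma comor_comp_map {A B : Type u} [CommRing A] [CommRing B] [Algebra K A] [Algebra K B]
    {W : KScheme K} (f : W ⟶ affineScheme K A)
    (φ : B →ₐ[K] A) (b : B) : comor K (f ≫ affineMap K φ) b = comor K f (φ b) := by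
  have h (h : W.left ⟶ Spec (.of A)) : (Scheme.ΓSpecIso (.of B)).inv ≫
      (h ≫ Spec.map (CommRingCat.ofHom φ.toRingHom)).appTop
     = CommRingCat.ofHom φ.toRingHom ≫ (Scheme.ΓSpecIso (.of A)).inv ≫ h.appTop := by
    rw [Scheme.Hom.comp_appTop,
      reassoc_of% Scheme.ΓSpecIso_inv_naturality (CommRingCat.ofHom φ.toRingHom)]
  exact congr($(h f.left).hom b)

lemma comor_inj {A : Type u} [CommRing A] [Algebra K A] {W : KScheme K}
    {f g : W ⟶ affineScheme K A} (h : comor K f = comor K g) : f = g := by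
  have h' (a b : W.left ⟶ Spec (.of A)) (hab : (Scheme.ΓSpecIso (.of A)).inv ≫ a.appTop =
      (Scheme.ΓSpecIso (.of A)).inv ≫ b.appTop) : a = b :=
    ext_of_isAffine ((cancel_epi _).mp hab)
  ext1
  exact h' f.left g.left (CommRingCat.hom_ext h)

lemma comor_algebraMap {A : Type u} [CommRing A] [Algebra K A]
    {W : KScheme K} (f g : W ⟶ affineScheme K A) (r : K) :
    comor K f (algebraMap K A r) = comor K g (algebraMap K A r) := by
  have h (f : W ⟶ affineScheme K A) : comor K f (algebraMap K A r) =
      comor K (f ≫ affineMap K (Algebra.ofId K A)) r := (comor_comp_map K f (Algebra.ofId K A) r).symm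
  rw [h f, h g]
  congr 2
  ext1
  exact (Over.w f).trans (Over.w g).symm

lemma comor_lift {A B : Type u} [CommRing A] [CommRing B] [Algebra K A] [Algebra K B]
    {W : KScheme K} (f : W ⟶ affineScheme K A) (g : W ⟶ affineScheme K B) (a : A) (b : B) :
    comor K (lift f g ≫ prodToSpec K A B) (a ⊗ₜ b) = comor K f a * comor K g b := by
  have h1 : comor K f a = comor K (lift f g ≫ prodToSpec K A B)
      (Algebra.TensorProduct.includeLeft (S := K) a) := by
    rw [← comor_comp_map, Category.assoc, prodToSpec_fst, lift_fst]
  have h2 : comor K g b = comor K (lift f g ≫ prodToSpec K A B)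
      (Algebra.TensorProduct.includeRight b) := by
    rw [← comor_comp_map, Category.assoc, prodToSpec_snd, lift_snd]
  rw [h1, h2, ← map_mul]
  simp

lemma comor_act {W : KScheme K} (f : W ⟶ torus K) (g : W ⟶ cone K)
    (i : Fin 4) : comor K (lift f g ≫ torusAct K) (coord K i) =
      comor K f (AddMonoidAlgebra.single (weight i) (1 : K)) * comor K g (coord K i) := by
  rw [← comor_lift, torusAct, ← Category.assoc, comor_comp_map]
  congr 1
  exact (Ideal.Quotient.lift_mk _ _ _).trans (MvPolynomial.aeval_X _ _)

lemma comor_mul {W : KScheme K} (f g : W ⟶ torus K) (w : ℤ × ℤ) :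
    comor K (lift f g ≫ μ[torus K]) (AddMonoidAlgebra.single w (1 : K)) =
      comor K f (AddMonoidAlgebra.single w (1 : K)) *
        comor K g (AddMonoidAlgebra.single w (1 : K)) := by
  have h : μ[torus K] = prodToSpec K _ _ ≫ affineMap K (Bialgebra.comulAlgHom K _) := rfl
  rw [← comor_lift, h, ← Category.assoc, comor_comp_map]
  congr 1
  simp

lemma comor_one {W : KScheme K} (w : ℤ × ℤ) :
    comor K (toUnit W ≫ η[torus K]) (AddMonoidAlgebra.single w (1 : K)) = 1 := by
  have h : toUnit W ≫ η[torus K] =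
      (Over.homMk W.hom (by
        change W.hom ≫ Spec.map (𝟙 _) = W.hom
        simp) : W ⟶ affineScheme K K) ≫ affineMap K (Bialgebra.counitAlgHom K _) := by
    ext1
    rfl
  rw [h, comor_comp_map]
  simp

lemma hom_ext_cone {W : KScheme K} {f g : W ⟶ cone K}
    (h : ∀ i, comor K f (coord K i) = comor K g (coord K i)) : f = g := by
  apply comor_inj
  apply Ideal.Quotient.ringHom_ext
  apply MvPolynomial.ringHom_ext
  · intro r
    exact comor_algebraMap K f g r
  · exact h

end

/-- The torus action on the cone. -/
instance torusAction (K : Type u) [Field K] : ModObj (torus K) (cone K) where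
  smul := torusAct K
  one_smul := by
    apply hom_ext_cone
    intro i
    have h : η[torus K] ▷ cone K =
        lift (toUnit _ ≫ η[torus K]) (snd _ _) := by
      ext1
      · rw [whiskerRight_fst, lift_fst]
        congr 1
      · rw [whiskerRight_snd, lift_snd]
    change comor K (η[torus K] ▷ cone K ≫ torusAct K) _ =
      comor K (λ_ _).hom _
    rw [h, comor_act, comor_one, _root_.one_mul, leftUnitor_hom]
  mul_smul := by
    apply hom_ext_cone
    intro i
    have h : μ[torus K] ▷ cone K =
        lift (lift (fst _ _ ≫ fst _ _) (fst _ _ ≫ snd _ _) ≫ μ[torus K]) (snd _ _) := by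
      ext1 <;> simp
    have h' : (α_ _ _ _).hom ≫ torus K ◁ torusAct K =
        lift (fst _ _ ≫ fst _ _) (lift (fst _ _ ≫ snd _ _) (snd _ _) ≫ torusAct K) := by
      ext1
      · simp
      · simp only [Category.assoc, whiskerLeft_snd, lift_snd]
        rw [← Category.assoc]
        congr 1
        ext1 <;> simp
    change comor K (μ[torus K] ▷ cone K ≫ torusAct K) _ =
      comor K ((α_ _ _ _).hom ≫ torus K ◁ torusAct K ≫ torusAct K) _
    rw [reassoc_of% h', h, comor_act, comor_act, comor_act, comor_mul, _root_.mul_assoc]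

end ConeGIT

end

open ConeGIT

/-! Nonexistence of `L`. The one-parameter subgroup λ(s) = (s⁻¹, s²) of the torus acts on z₁, z₂,
z₃, z₄ with weights -2, 3, 1, -4. So λ(s) contracts the points with z₁ = z₄ = 0 to the vertex for s
→ 0, and those with z₂ = z₃ = 0 for s → ∞. Points of both kinds occur in U, but the vertex is not in
U. If U were the semistable locus of `L`, a point of either kind would have an invariant section of
a power of `L` that is nonzero at it. This section vanishes at the vertex, since otherwise its
affine nonvanishing locus would make the vertex semistable. Vanishing in the limit fixes the sign of
the weight of λ on the fibre of `L` over the vertex, and the two limits demand opposite signs.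

A single element suffices, namely λ(2). It acts on that fibre by a scalar a, and the two limits give
aⁿ = 2ᵏ and aᵐ = 2⁻ˡ with positive exponents, which is impossible in characteristic zero. The
relations come from `exists_pow_eq_of_isInvariantSection`, which writes the section along a formal
disc as a power series times a frame; no global trivialization of `L` is needed.

The quotient. On the patch z₂z₃ ≠ 0 the invariants form the polynomial ring in z₁z₂²/z₃⁴, on the
patch z₁z₄ ≠ 0 the one in z₂²z₄⁴/z₁⁵ (`mem_range_of_invariant`, by comparing weights of monomials).
As z₁z₃ = z₂z₄, these generators are inverse to each other on the overlap, so the two quotient lines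
glue to the projective line. The preimage of each standard chart is exactly one patch
(`quotientMap_mem_chartOpen_iff`), which makes the morphism affine; `isGoodQuotient_of_cover` passes
from the charts to all open sets. The orbits are found with the slices (d, 1, 1, d) and (1, d, d, 1)
(`exists_patch_point`). -/

noncomputable section

namespace ConeGIT

/-! ### Morphisms to affine schemes as ring homomorphisms -/

section Affine

variable (K : Type u) [Field K]

lemma comor_comp {A : Type u} [CommRing A] [Algebra K A] {W W' : KScheme K} (h : W' ⟶ W)
    (f : W ⟶ affineScheme K A) (a : A) :
    comor K (h ≫ f) a = h.left.appTop (comor K f a) := by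
  have key {X Y : Scheme.{u}} (h : X ⟶ Y) (f : Y ⟶ Spec (.of A)) :
      (Scheme.ΓSpecIso (.of A)).inv ≫ (h ≫ f).appTop =
        ((Scheme.ΓSpecIso (.of A)).inv ≫ f.appTop) ≫ h.appTop := by
    rw [Scheme.Hom.comp_appTop, Category.assoc]
  exact congr(($(key h.left f.left)).hom a)

/-- The functions on an affine scheme. -/
def toΓ (A : Type u) [CommRing A] [Algebra K A] : A →+* Γ((affineScheme K A).left, ⊤) :=
  comor K (𝟙 (affineScheme K A))

lemma toΓ_bijective (A : Type u) [CommRing A] [Algebra K A] : Function.Bijective (toΓ K A) := by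
  have key (f : Spec (.of A) ⟶ Spec (.of A)) [IsIso f] : Function.Bijective
      ((Scheme.ΓSpecIso (.of A)).inv ≫ f.appTop).hom := by
    have : IsIso f.appTop := inferInstanceAs (IsIso (f.app ⊤))
    exact ConcreteCategory.bijective_of_isIso ((Scheme.ΓSpecIso (.of A)).inv ≫ f.appTop)
  exact key (𝟙 _)

lemma comor_eq {A : Type u} [CommRing A] [Algebra K A] {W : KScheme K}
    (f : W ⟶ affineScheme K A) (a : A) : comor K f a = f.left.appTop (toΓ K A a) := by
  rw [toΓ, ← comor_comp, Category.comp_id]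

/-- A morphism between affine schemes is given by a homomorphism of algebras. -/
lemma exists_affineMap_eq {A B : Type u} [CommRing A] [CommRing B] [Algebra K A] [Algebra K B]
    (f : affineScheme K B ⟶ affineScheme K A) : ∃ φ : A →ₐ[K] B, f = affineMap K φ := by
  have key (g : Spec (.of B) ⟶ Spec (.of A)) (hg : g ≫ Spec.map (CommRingCat.ofHom
      (algebraMap K A)) = Spec.map (CommRingCat.ofHom (algebraMap K B))) :
      CommRingCat.ofHom (algebraMap K A) ≫ Spec.preimage g =
        CommRingCat.ofHom (algebraMap K B) := by
    apply Spec.map_injective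
    rw [Spec.map_comp, Spec.map_preimage, hg]
  have hf := key f.left (Over.w f)
  refine ⟨{ (Spec.preimage f.left).hom with commutes' := fun r => congr($(hf).hom r) }, ?_⟩
  ext1
  exact (Spec.map_preimage f.left).symm

lemma affineMap_comp {A B C : Type u} [CommRing A] [CommRing B] [CommRing C] [Algebra K A]
    [Algebra K B] [Algebra K C] (φ : A →ₐ[K] B) (ψ : B →ₐ[K] C) :
    affineMap K ψ ≫ affineMap K φ = affineMap K (ψ.comp φ) := by
  ext1
  exact (Spec.map_comp _ _).symm

lemma affineMap_injective {A B : Type u} [CommRing A] [CommRing B] [Algebra K A] [Algebra K B]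
    {φ ψ : A →ₐ[K] B} (h : affineMap K φ = affineMap K ψ) : φ = ψ := by
  have h' : Spec.map (CommRingCat.ofHom φ.toRingHom) = Spec.map (CommRingCat.ofHom ψ.toRingHom) :=
    congr(($h).left)
  ext a
  exact congr(($(Spec.map_injective h')).hom a)

lemma comor_affineMap {A B : Type u} [CommRing A] [CommRing B] [Algebra K A] [Algebra K B]
    (φ : A →ₐ[K] B) (a : A) :
    comor K (affineMap K φ) a = toΓ K B (φ a) := by
  have h := comor_comp_map K (𝟙 (affineScheme K B)) φ a
  rwa [Category.id_comp] at h

lemma asOver_hom_eq_id : (affineScheme K K).hom = 𝟙 (Spec (CommRingCat.of K)) :=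
  (congrArg Spec.map (CommRingCat.hom_ext rfl : CommRingCat.ofHom (algebraMap K K) = 𝟙 _)).trans
    (Spec.map_id _)

/-- The structure morphism of a `K`-scheme. -/
def toSpec (W : KScheme K) : W ⟶ affineScheme K K :=
  Over.homMk W.hom (by rw [asOver_hom_eq_id]; exact Category.comp_id _)

lemma hom_toSpec_unique {W : KScheme K} (f g : W ⟶ affineScheme K K) : f = g := by
  apply comor_inj
  ext r
  exact comor_algebraMap K f g r

lemma toSpec_eq_affineMap (A : Type u) [CommRing A] [Algebra K A] :
    toSpec K (affineScheme K A) = affineMap K (Algebra.ofId K A) := hom_toSpec_unique K _ _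

end Affine

/-! ### Points of the affine line as functions -/

section Scalars

variable (K : Type u) [Field K]

/-- The coordinate of a morphism to the affine line. -/
def value {W : KScheme K} (a : W ⟶ affineLine K) : Γ(W.left, ⊤) :=
  comor K a (AddMonoidAlgebra.single 1 1)

variable {K}

lemma value_injective {W : KScheme K} {a b : W ⟶ affineLine K} (h : value K a = value K b) :
    a = b := by
  apply comor_inj
  refine AddMonoidAlgebra.ringHom_ext (fun r => ?_) (fun n => ?_)
  · exact comor_algebraMap K a b r
  · have (c : W ⟶ affineLine K) : comor K c (AddMonoidAlgebra.single n 1) = value K c ^ n := by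
      rw [value, ← map_pow, AddMonoidAlgebra.single_pow]
      simp
    rw [this, this, h]

lemma value_comp {W W' : KScheme K} (h : W' ⟶ W) (a : W ⟶ affineLine K) :
    value K (h ≫ a) = h.left.appTop (value K a) := comor_comp K h a _

lemma value_mul {W : KScheme K} (a b : W ⟶ affineLine K) :
    value K (a * b) = value K a * value K b := by
  have h : μ[affineLine K] = prodToSpec K _ _ ≫ affineMap K (Bialgebra.comulAlgHom K _) := rfl
  rw [value, value, value, ← comor_lift, Hom.mul_def, h, ← Category.assoc, comor_comp_map]
  congr 1
  simp

variable (K) in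
/-- The morphism to the affine line given by an element of the coordinate ring. -/
def scalar {R : Type u} [CommRing R] [Algebra K R] (r : R) : affineScheme K R ⟶ affineLine K :=
  affineMap K (AddMonoidAlgebra.lift K R ℕ (powersHom R r))

lemma value_scalar {R : Type u} [CommRing R] [Algebra K R] (r : R) :
    value K (scalar K r) = toΓ K R r := by
  rw [value, scalar, comor_affineMap]
  simp

lemma scalar_injective {R : Type u} [CommRing R] [Algebra K R] {r s : R}
    (h : scalar K r = scalar K s) : r = s := by
  have h' := congr(value K $h)
  rw [value_scalar, value_scalar] at h'
  exact (toΓ_bijective K R).1 h'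

lemma exists_scalar_eq {R : Type u} [CommRing R] [Algebra K R]
    (a : affineScheme K R ⟶ affineLine K) : ∃ r : R, a = scalar K r := by
  obtain ⟨r, hr⟩ := (toΓ_bijective K R).2 (value K a)
  exact ⟨r, value_injective (by rw [value_scalar, hr])⟩

lemma scalar_mul {R : Type u} [CommRing R] [Algebra K R] (r s : R) :
    scalar K (r * s) = scalar K r * scalar K s :=
  value_injective (by rw [value_mul, value_scalar, value_scalar, value_scalar, map_mul])

/-- Both sides are neutral for multiplication, since the monoid unit is itself of the form `scalar K
r`. -/
lemma scalar_one {R : Type u} [CommRing R] [Algebra K R] : scalar K (1 : R) = 1 := by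
  have h : scalar K (1 : R) * 1 = scalar K (1 : R) := _root_.mul_one _
  obtain ⟨r, hr⟩ := exists_scalar_eq (1 : affineScheme K R ⟶ affineLine K)
  have h' : scalar K (1 : R) * scalar K r = scalar K r := by
    rw [← scalar_mul, _root_.one_mul]
  rw [← hr] at h'
  exact h.symm.trans h'

lemma scalar_pow {R : Type u} [CommRing R] [Algebra K R] (r : R) (n : ℕ) :
    scalar K (r ^ n) = scalar K r ^ n := by
  induction n with
  | zero => rw [pow_zero, pow_zero, scalar_one]
  | succ n ih => rw [pow_succ, pow_succ, scalar_mul, ih]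

lemma affineMap_comp_scalar {R S : Type u} [CommRing R] [Algebra K R] [CommRing S] [Algebra K S]
    (φ : R →ₐ[K] S) (r : R) : affineMap K φ ≫ scalar K r = scalar K (φ r) := by
  rw [scalar, scalar, affineMap_comp]
  congr 1
  ext
  simp

lemma value_origin (W : KScheme K) : value K (toUnit W ≫ origin K) = 0 := by
  have h : toUnit W ≫ origin K = (toUnit W ≫ toSpec K _) ≫ scalar K (0 : K) := by
    rw [Category.assoc]
    congr 1
  rw [h, value_comp, value_scalar, map_zero, map_zero]

lemma scalar_zero {R : Type u} [CommRing R] [Algebra K R] :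
    scalar K (0 : R) = toUnit _ ≫ origin K :=
  value_injective (by rw [value_origin, value_scalar, map_zero])

end Scalars

end ConeGIT

end

noncomputable section

namespace ConeGIT

/-! ### Open immersions over the base field -/

section OpenSub

variable {K : Type u} [Field K]

instance openIncl_left_isOpenImmersion (X : KScheme K) (V : X.left.Opens) :
    IsOpenImmersion (openIncl X V).left :=
  inferInstanceAs (IsOpenImmersion V.ι)

instance openIncl_mono (X : KScheme K) (V : X.left.Opens) : Mono (openIncl X V) :=
  (Over.forget _).mono_of_mono_map (inferInstanceAs (Mono V.ι))

/-- Lift a morphism along an open immersion of `K`-schemes. -/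
def immersionLift {W X Y : KScheme K} (j : Y ⟶ X) [IsOpenImmersion j.left] (f : W ⟶ X)
    (hf : Set.range f.left ⊆ Set.range j.left) : W ⟶ Y :=
  Over.homMk (IsOpenImmersion.lift j.left f.left hf) (by
    rw [← Over.w j, ← Category.assoc, IsOpenImmersion.lift_fac, Over.w f])

lemma immersionLift_comp {W X Y : KScheme K} (j : Y ⟶ X) [IsOpenImmersion j.left] (f : W ⟶ X)
    (hf : Set.range f.left ⊆ Set.range j.left) : immersionLift j f hf ≫ j = f := by
  ext1
  exact IsOpenImmersion.lift_fac _ _ _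

lemma range_openIncl (X : KScheme K) (V : X.left.Opens) :
    Set.range (openIncl X V).left = (V : Set X.left) :=
  V.range_ι

end OpenSub

/-! ### Local frames and the zero section of a line bundle -/

section Frames

variable {K : Type u} [Field K] {X : KScheme K}

/-- A frame of a line bundle over a scheme `W` over its base: a morphism `W ⟶ L` of which, after
every base change, every other section is a unique multiple. -/
def LineBundle.IsFrame (L : LineBundle X) {W : KScheme K} (e : W ⟶ L.total) : Prop :=
  ∀ ⦃W' : KScheme K⦄ (h : W' ⟶ W) (e' : W' ⟶ L.total), e' ≫ L.proj = h ≫ e ≫ L.proj →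
    ∃! a : W' ⟶ affineLine K, a • (h ≫ e) = e'

variable {L : LineBundle X}

lemma LineBundle.smul_proj (L : LineBundle X) {W : KScheme K} (a : W ⟶ affineLine K)
    (e : W ⟶ L.total) : (a • e) ≫ L.proj = e ≫ L.proj := by
  rw [Hom.smul_def, Category.assoc]
  have := L.scalar_proj
  rw [act] at this
  rw [this, ← Category.assoc, lift_snd]

lemma LineBundle.IsFrame.comp {W W' : KScheme K} {e : W ⟶ L.total} (he : L.IsFrame e)
    (h : W' ⟶ W) : L.IsFrame (h ≫ e) := by
  intro W'' h' e' he'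
  have := he (h' ≫ h) e' (by simpa using he')
  simpa using this

lemma LineBundle.IsFrame.exists_smul_eq {W : KScheme K} {e e' : W ⟶ L.total} (he : L.IsFrame e)
    (h : e' ≫ L.proj = e ≫ L.proj) : ∃ a : W ⟶ affineLine K, a • e = e' := by
  obtain ⟨a, ha, -⟩ := he (𝟙 W) e' (by simpa using h)
  exact ⟨a, by simpa using ha⟩

lemma LineBundle.IsFrame.smul_injective {W : KScheme K} {e : W ⟶ L.total} (he : L.IsFrame e)
    {a b : W ⟶ affineLine K} (h : a • e = b • e) : a = b := by
  apply (he (𝟙 W) (b • e) (by simp [L.smul_proj])).unique <;> simp [h]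

/-- Every point of the spectrum of a local ring specializes to the closed point, so an open set that
trivializes the bundle near the image of the closed point contains the whole image. The constant
section 1 of the trivial bundle is then a frame. -/
lemma LineBundle.exists_isFrame_of_local (L : LineBundle X) {R : Type u} [CommRing R] [IsLocalRing R]
    [Algebra K R] (c : affineScheme K R ⟶ X) :
    ∃ e : affineScheme K R ⟶ L.total, e ≫ L.proj = c ∧ L.IsFrame e := by
  obtain ⟨V, hV, φ, hφ, hlin⟩ := L.locally_trivial (c.left (IsLocalRing.closedPoint R))
  have hr : Set.range c.left ⊆ Set.range (openIncl X V).left := by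
    rw [range_openIncl]
    rintro _ ⟨x, rfl⟩
    have hx : x ⤳ (IsLocalRing.closedPoint R : (affineScheme K R).left) :=
      IsLocalRing.specializes_closedPoint (R := R) x
    exact (hx.map c.left.continuous).mem_open V.2 hV
  let c' := immersionLift (openIncl X V) c hr
  have hc' : c' ≫ openIncl X V = c := immersionLift_comp _ _ _
  have hsmul {W : KScheme K} (a b : W ⟶ affineLine K) (f : W ⟶ openSub X V) :
      a • (lift b f ≫ φ) = lift (a * b) f ≫ φ := by
    have h1 : lift a (lift b f ≫ φ) = lift a (lift b f) ≫ affineLine K ◁ φ := by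
      ext1 <;> simp
    have h2 : lift a (lift b f) ≫ (α_ _ _ _).inv ≫ μ[affineLine K] ▷ openSub X V =
        lift (a * b) f := by
      rw [lift_lift_associator_inv_assoc, lift_whiskerRight, Hom.mul_def]
    rw [Hom.smul_def, h1, Category.assoc]
    rw [act] at hlin
    rw [hlin, ← reassoc_of% h2]
  have hproj {W : KScheme K} (b : W ⟶ affineLine K) (f : W ⟶ openSub X V) :
      (lift b f ≫ φ) ≫ L.proj = f ≫ openIncl X V := by
    rw [Category.assoc, hφ.w, lift_snd_assoc]
  refine ⟨lift 1 c' ≫ φ, ?_, ?_⟩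
  · rw [hproj, hc']
  · intro W h e' he'
    have key (a : W ⟶ affineLine K) : a • (h ≫ lift 1 c' ≫ φ) = lift a (h ≫ c') ≫ φ := by
      rw [← Category.assoc, comp_lift, MonObj.comp_one, hsmul, _root_.mul_one]
    rw [hproj] at he'
    have he'' : e' ≫ L.proj = (h ≫ c') ≫ openIncl X V := by rw [he', Category.assoc]
    refine ⟨hφ.lift e' (h ≫ c') he'' ≫ fst _ _, ?_, ?_⟩
    · dsimp only
      rw [key]
      have : lift (hφ.lift e' (h ≫ c') he'' ≫ fst _ _) (h ≫ c') = hφ.lift e' (h ≫ c') he'' := by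
        ext1
        · simp
        · rw [lift_snd, hφ.lift_snd]
      rw [this, hφ.lift_fst]
    · intro b hb
      rw [key] at hb
      have : lift b (h ≫ c') = hφ.lift e' (h ≫ c') he'' := by
        apply hφ.hom_ext
        · rw [hb, hφ.lift_fst]
        · rw [lift_snd, hφ.lift_snd]
      rw [← this, lift_fst]

/-- The endomorphism `e ↦ 0 • e` of the total space. -/
def LineBundle.zeroMap (L : LineBundle X) : L.total ⟶ L.total :=
  lift (toUnit L.total ≫ origin K) (𝟙 L.total) ≫ act (affineLine K) L.total

lemma LineBundle.comp_zeroMap (L : LineBundle X) {W : KScheme K} (e : W ⟶ L.total) :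
    e ≫ L.zeroMap = (toUnit W ≫ origin K) • e := by
  rw [zeroMap, Hom.smul_def, ← Category.assoc, comp_lift, Category.comp_id, ← Category.assoc,
    comp_toUnit]

lemma LineBundle.zero_smul_mem_zeroLocus (L : LineBundle X) {W : KScheme K} (e : W ⟶ L.total)
    (x : W.left) : ((toUnit W ≫ origin K) • e : W ⟶ L.total).left x ∈ L.zeroLocus := by
  rw [← L.comp_zeroMap]
  exact ⟨e.left x, rfl⟩

/-- Membership in the zero locus is a statement about points of the underlying space. It becomes an
equation of morphisms on the nonempty fibre product of `a • e` with `e ↦ 0 • e`, where uniqueness of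
the coefficient forces `a` to restrict to 0. -/
lemma LineBundle.IsFrame.not_isUnit_of_mem_zeroLocus {W : KScheme K} {e : W ⟶ L.total}
    (he : L.IsFrame e) (a : W ⟶ affineLine K) {x : W.left}
    (hx : (a • e : W ⟶ L.total).left x ∈ L.zeroLocus) : ¬ IsUnit (value K a) := by
  obtain ⟨y, hy⟩ := hx
  change L.zeroMap.left y = _ at hy
  obtain ⟨z, hz⟩ := Scheme.Pullback.exists_preimage_pullback
    (f := (a • e : W ⟶ L.total).left) (g := L.zeroMap.left) x y hy.symm
  let P : KScheme K := Over.mk (Limits.pullback.fst (a • e : W ⟶ L.total).left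
    L.zeroMap.left ≫ W.hom)
  let h : P ⟶ W := Over.homMk (Limits.pullback.fst _ _) rfl
  let k : P ⟶ L.total := Over.homMk (Limits.pullback.snd _ _) (by
    change _ = Limits.pullback.fst _ _ ≫ W.hom
    rw [← Over.w (a • e : W ⟶ L.total), Limits.pullback.condition_assoc, Over.w L.zeroMap])
  have hk : h ≫ (a • e) = k ≫ L.zeroMap := by
    ext1
    exact Limits.pullback.condition
  rw [ModObj.comp_smul, L.comp_zeroMap] at hk
  -- As 0 · 0 = 0, the section `a • e` on `P` equals its own multiple by 0.
  have hz' : ((toUnit P ≫ origin K) * (toUnit P ≫ origin K) : P ⟶ affineLine K) =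
      toUnit P ≫ origin K := value_injective (by simp [value_mul, value_origin])
  have hk' : ((toUnit P ≫ origin K) * (h ≫ a)) • (h ≫ e) = (h ≫ a) • (h ≫ e) := by
    rw [mul_smul, hk]
    exact (mul_smul _ _ k).symm.trans (by rw [hz'])
  have h0 := congr(value K $((he.comp h).smul_injective hk'))
  rw [value_mul, value_origin, zero_mul, value_comp] at h0
  intro hu
  have hu' := hu.map h.left.appTop.hom
  change IsUnit (h.left.appTop (value K a)) at hu'
  rw [← h0] at hu'
  have : Nonempty (⊤ : P.left.Opens) := ⟨⟨z, trivial⟩⟩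
  exact not_isUnit_zero hu'

end Frames

end ConeGIT

end

noncomputable section

namespace ConeGIT

/-! ### Formal discs and the Hilbert–Mumford weight -/

section Weights

variable {K : Type u} [Field K] {G : KScheme K} [MonObj G] {X : KScheme K} [ModObj G X]

namespace LinearizedLineBundle

lemma smul_proj_eq (M : LinearizedLineBundle G X) {W : KScheme K} (g : W ⟶ G)
    (e : W ⟶ M.total) : (g • e) ≫ M.proj = g • (e ≫ M.proj) := by
  have h := M.proj_equivariant
  rw [act, act] at h
  rw [Hom.smul_def, Hom.smul_def, Category.assoc, h, ← Category.assoc]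
  congr 1
  ext1 <;> simp

lemma scalar_smul_comm (M : LinearizedLineBundle G X) {W : KScheme K} (g : W ⟶ G)
    (a : W ⟶ affineLine K) (e : W ⟶ M.total) : a • (g • e) = g • (a • e) := by
  have h := congr(lift a (lift g e) ≫ $(M.linear))
  rw [act, act] at h
  have h1 : lift a (lift g e) ≫ affineLine K ◁ γ[G, M.total] = lift a (g • e) := by
    ext1 <;> simp [Hom.smul_def]
  have h2 : lift a (lift g e) ≫ lift (snd (affineLine K) (G ⊗ M.total) ≫ fst G M.total)
      (lift (fst (affineLine K) (G ⊗ M.total)) (snd (affineLine K) (G ⊗ M.total) ≫ snd G M.total))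
      ≫ G ◁ γ[affineLine K, M.total] = lift g (a • e) := by
    ext1 <;> simp [Hom.smul_def, comp_lift_assoc]
  rw [reassoc_of% h1, reassoc_of% h2] at h
  exact h

lemma IsInvariantSection.smul_comp {M : LinearizedLineBundle G X} {s : X ⟶ M.total}
    (hs : M.IsInvariantSection s) {W : KScheme K} (g : W ⟶ G) (c : W ⟶ X) :
    (g • c) ≫ s = g • (c ≫ s) := by
  have h := hs.equivariant
  rw [act, act] at h
  rw [Hom.smul_def, Hom.smul_def, Category.assoc, h, ← Category.assoc]
  congr 1
  ext1 <;> simp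

variable {n : ℕ} {L M : LinearizedLineBundle G X} {ν : L.total ⟶ M.total}

lemma IsPower.smul_comp (h : L.IsPower n M ν) {W : KScheme K} (g : W ⟶ G) (e : W ⟶ L.total) :
    (g • e) ≫ ν = g • (e ≫ ν) := by
  have h := h.equivariant
  rw [act, act] at h
  rw [Hom.smul_def, Hom.smul_def, Category.assoc, h, ← Category.assoc]
  congr 1
  ext1 <;> simp

lemma IsPower.scalar_smul_comp (h : L.IsPower n M ν) {W : KScheme K} (a : W ⟶ affineLine K)
    (e : W ⟶ L.total) : (a • e) ≫ ν = (a ^ n) • (e ≫ ν) := by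
  have h := h.homogeneous
  rw [act, act] at h
  rw [Hom.smul_def, Hom.smul_def, Category.assoc, h, ← Category.assoc]
  congr 1
  ext1
  · rw [Category.assoc, tensorHom_fst, lift_fst_assoc, MonObj.comp_pow, Category.comp_id, lift_fst]
  · simp

end LinearizedLineBundle

lemma scalar_mul_smul {R : Type u} [CommRing R] [Algebra K R] {E : KScheme K}
    [ModObj (affineLine K) E] (r s : R) (e : affineScheme K R ⟶ E) :
    scalar K (r * s) • e = scalar K r • scalar K s • e := by
  rw [scalar_mul, mul_smul]

variable (K) in
/-- The constant coefficient of power series as a homomorphism of algebras. -/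
def constantCoeffAlgHom : PowerSeries K →ₐ[K] K :=
  { PowerSeries.constantCoeff (R := K) with
    commutes' := fun r => PowerSeries.constantCoeff_C r }

/-- The substitution `t ↦ q t` of power series as a homomorphism of algebras. -/
def rescaleAlgHom (q : K) : PowerSeries K →ₐ[K] PowerSeries K :=
  { PowerSeries.rescale q with
    commutes' := fun r => by
      ext n
      simp only [RingHom.toMonoidHom_eq_coe, OneHom.toFun_eq_coe, MonoidHom.toOneHom_coe,
        MonoidHom.coe_coe, PowerSeries.algebraMap_apply, PowerSeries.coeff_rescale,
        PowerSeries.coeff_C]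
      split_ifs with h <;> simp [h] }

lemma constantCoeffAlgHom_apply (f : PowerSeries K) :
    constantCoeffAlgHom K f = PowerSeries.constantCoeff f := rfl

lemma rescaleAlgHom_apply (q : K) (f : PowerSeries K) :
    rescaleAlgHom q f = PowerSeries.rescale q f := rfl

variable (K) in
/-- The closed point of the formal disc. -/
def discOrigin : affineScheme K K ⟶ affineScheme K (PowerSeries K) :=
  affineMap K (constantCoeffAlgHom K)

/-- The automorphism `t ↦ q t` of the formal disc. -/
def discRescale (q : K) : affineScheme K (PowerSeries K) ⟶ affineScheme K (PowerSeries K) :=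
  affineMap K (rescaleAlgHom q)

lemma discOrigin_rescale (q : K) : discOrigin K ≫ discRescale q = discOrigin K := by
  rw [discOrigin, discRescale, affineMap_comp]
  congr 1
  refine AlgHom.ext fun f => ?_
  rw [AlgHom.comp_apply, rescaleAlgHom_apply, constantCoeffAlgHom_apply, constantCoeffAlgHom_apply,
    ← PowerSeries.coeff_zero_eq_constantCoeff_apply, PowerSeries.coeff_rescale]
  simp

lemma discOrigin_scalar (f : PowerSeries K) :
    discOrigin K ≫ scalar K f = scalar K (PowerSeries.constantCoeff f) :=
  affineMap_comp_scalar (constantCoeffAlgHom K) f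

lemma discRescale_scalar (q : K) (f : PowerSeries K) :
    discRescale q ≫ scalar K f = scalar K (PowerSeries.rescale q f) :=
  affineMap_comp_scalar (rescaleAlgHom q) f

/-- Comparison of lowest coefficients: the one of f(qt) is qᵏ times that of f, where k is the order
of f, and k is positive because f(0) = 0. -/
lemma exists_pow_of_rescale_eq_mul {q : K} {f u : PowerSeries K} (hf : f ≠ 0)
    (h0 : PowerSeries.constantCoeff f = 0) (h : PowerSeries.rescale q f = f * u) :
    ∃ k : ℕ, 0 < k ∧ PowerSeries.constantCoeff u = q ^ k := by
  obtain ⟨g, hg⟩ := PowerSeries.X_pow_order_dvd (φ := f)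
  set k := f.order.toNat with hk
  have hfk : PowerSeries.coeff k f ≠ 0 := PowerSeries.coeff_order hf
  have hgk : PowerSeries.coeff k f = PowerSeries.constantCoeff g := by
    conv_lhs => rw [hg]
    simpa using PowerSeries.coeff_X_pow_mul g k 0
  refine ⟨k, Nat.pos_of_ne_zero ?_, ?_⟩
  · intro hk0
    rw [hk0] at hfk
    exact hfk (by simpa using h0)
  · have h1 := congr(PowerSeries.coeff k $h)
    rw [PowerSeries.coeff_rescale] at h1
    have h2 : PowerSeries.coeff k (f * u) =
        PowerSeries.constantCoeff g * PowerSeries.constantCoeff u := by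
      conv_lhs => rw [hg, _root_.mul_assoc]
      simpa using PowerSeries.coeff_X_pow_mul (g * u) k 0
    rw [h2, hgk, mul_comm] at h1
    rw [hgk] at hfk
    exact (mul_left_cancel₀ hfk h1).symm

open LinearizedLineBundle in
/-- The Hilbert–Mumford weight: a one-parameter limit at which an invariant section of a power of
`L` vanishes determines the character on the fibre over the limit point. -/
lemma exists_pow_eq_of_isInvariantSection {n : ℕ} {L M : LinearizedLineBundle G X}
    {ν : L.total ⟶ M.total} (hν : L.IsPower n M ν) {s : X ⟶ M.total}
    (hs : M.IsInvariantSection s) {q : K} {c : affineScheme K (PowerSeries K) ⟶ X}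
    {g : affineScheme K K ⟶ G}
    (hg : (toSpec K (affineScheme K (PowerSeries K)) ≫ g) • c = discRescale q ≫ c)
    (h0 : ∃ x, (discOrigin K ≫ c ≫ s).left x ∈ M.zeroLocus)
    (h1 : ∃ x, (c ≫ s).left x ∉ M.zeroLocus)
    {e₀ : affineScheme K K ⟶ L.total} (he₀ : L.IsFrame e₀)
    (hproj : e₀ ≫ L.proj = discOrigin K ≫ c) {a : K} (ha : g • e₀ = scalar K a • e₀) :
    ∃ k : ℕ, 0 < k ∧ a ^ n = q ^ k := by
  -- The power series ring is local, so the power bundle `M` has a frame along the whole disc; the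
  -- section along the disc becomes a power series `f`.
  obtain ⟨e, hec, he⟩ := M.exists_isFrame_of_local c
  have hcs : (c ≫ s) ≫ M.proj = e ≫ M.proj := by
    rw [hec, Category.assoc, hs.section_proj, Category.comp_id]
  obtain ⟨f', hf'⟩ := he.exists_smul_eq hcs
  obtain ⟨f, rfl⟩ := exists_scalar_eq f'
  -- Acting by `g` on the frame and moving the frame along t ↦ qt give two sections over the same
  -- map to `X`; they differ by a power series `u`.
  have hge : ((toSpec K (affineScheme K (PowerSeries K)) ≫ g) • e) ≫ M.proj =
      (discRescale q ≫ e) ≫ M.proj := by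
    rw [smul_proj_eq, hec, hg, Category.assoc, hec]
  obtain ⟨u', hu'⟩ := (he.comp (discRescale q)).exists_smul_eq hge
  obtain ⟨u, rfl⟩ := exists_scalar_eq u'
  -- In terms of the frame, invariance of the section reads f(qt) = f(t) u(t).
  have hfu : PowerSeries.rescale q f = f * u := by
    have h2 : scalar K (PowerSeries.rescale q f) • (discRescale q ≫ e) =
        scalar K (f * u) • (discRescale q ≫ e) := by
      calc scalar K (PowerSeries.rescale q f) • (discRescale q ≫ e)
          = discRescale q ≫ (scalar K f • e) := by
            rw [ModObj.comp_smul, discRescale_scalar]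
        _ = (toSpec K (affineScheme K (PowerSeries K)) ≫ g) • (scalar K f • e) := by
            rw [hf', ← hs.smul_comp, hg, Category.assoc]
        _ = _ := by
            rw [← scalar_smul_comm, ← hu', scalar_mul_smul]
    exact scalar_injective ((he.comp (discRescale q)).smul_injective h2)
  have hf0 : PowerSeries.constantCoeff f = 0 := by
    obtain ⟨x, hx⟩ := h0
    rw [← hf', ModObj.comp_smul, discOrigin_scalar] at hx
    have := (he.comp (discOrigin K)).not_isUnit_of_mem_zeroLocus _ hx
    rw [value_scalar] at this
    by_contra hne
    exact this ((IsUnit.mk0 _ hne).map _)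
  have hf1 : f ≠ 0 := by
    rintro rfl
    obtain ⟨x, hx⟩ := h1
    rw [← hf', scalar_zero] at hx
    exact hx (M.zero_smul_mem_zeroLocus _ _)
  obtain ⟨k, hk, hku⟩ := exists_pow_of_rescale_eq_mul hf1 hf0 hfu
  refine ⟨k, hk, ?_⟩
  -- The closed point is fixed by rescaling, so at t = 0 the factor `u` is the scalar by which `g`
  -- acts on the fibre of `M`.
  have hgo : g • (discOrigin K ≫ e) = scalar K (q ^ k) • (discOrigin K ≫ e) := by
    have h2 := congr(discOrigin K ≫ $hu')
    rw [ModObj.comp_smul, ModObj.comp_smul, ← Category.assoc, discOrigin_rescale,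
      ← Category.assoc, hom_toSpec_unique K (discOrigin K ≫ toSpec K _) (𝟙 _),
      Category.id_comp, discOrigin_scalar, hku] at h2
    exact h2.symm
  have hνo : (e₀ ≫ ν) ≫ M.proj = (discOrigin K ≫ e) ≫ M.proj := by
    rw [Category.assoc, hν.comp_proj, hproj, Category.assoc, hec]
  obtain ⟨b', hb'⟩ := (he.comp (discOrigin K)).exists_smul_eq hνo
  obtain ⟨b, rfl⟩ := exists_scalar_eq b'
  -- The power map `ν` vanishes only on the zero section, and `e₀ = 1 • e₀` does not meet it.
  have hb : b ≠ 0 := by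
    rintro rfl
    let x : (affineScheme K K).left := IsLocalRing.closedPoint K
    have hx : (e₀ ≫ ν).left x ∈ M.zeroLocus := by
      rw [← hb', scalar_zero]
      exact M.zero_smul_mem_zeroLocus _ _
    have hx' : (scalar K (1 : K) • e₀ : affineScheme K K ⟶ L.total).left x ∈ L.zeroLocus := by
      rw [scalar_one, one_smul]
      exact hν.nonvanishing _ hx
    have := he₀.not_isUnit_of_mem_zeroLocus _ hx'
    rw [value_scalar] at this
    exact this (isUnit_one.map _)
  -- Two computations of `g • ν(e₀)`: by homogeneity of `ν` it has the factor aⁿ, by the action on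
  -- the fibre of `M` the factor qᵏ.
  have h3 : scalar K (b * a ^ n) • (discOrigin K ≫ e) =
      scalar K (b * q ^ k) • (discOrigin K ≫ e) := by
    calc scalar K (b * a ^ n) • (discOrigin K ≫ e)
        = (scalar K a ^ n) • (e₀ ≫ ν) := by
          rw [← hb', mul_comm, scalar_mul_smul, scalar_pow]
      _ = g • (e₀ ≫ ν) := by rw [← hν.scalar_smul_comp, ← ha, hν.smul_comp]
      _ = _ := by
          rw [← hb', ← scalar_smul_comm, hgo, scalar_mul_smul]
  exact mul_left_cancel₀ hb (scalar_injective ((he.comp (discOrigin K)).smul_injective h3))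

end Weights

end ConeGIT

end

noncomputable section

namespace ConeGIT

/-! ### Points of the cone and of the torus -/

section Points

variable {K : Type u} [Field K]

/-- The point of the cone with given coordinates in a `K`-algebra. -/
def coneHom {R : Type u} [CommRing R] [Algebra K R] (z : Fin 4 → R) (h : z 0 * z 2 = z 1 * z 3) :
    coneRing K →ₐ[K] R :=
  Ideal.Quotient.liftₐ (coneIdeal K) (MvPolynomial.aeval z) (by
    intro a ha
    have h' : coneIdeal K ≤ RingHom.ker (MvPolynomial.aeval (R := K) z) := by
      rw [Ideal.span_le, Set.singleton_subset_iff, SetLike.mem_coe, RingHom.mem_ker]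
      simp [h]
    exact h' ha)

lemma coneHom_coord {R : Type u} [CommRing R] [Algebra K R] (z : Fin 4 → R)
    (h : z 0 * z 2 = z 1 * z 3) (i : Fin 4) : coneHom z h (coord K i) = z i :=
  (Ideal.Quotient.lift_mk _ _ _).trans (MvPolynomial.aeval_X _ _)

lemma coneRing_algHom_ext {R : Type u} [CommRing R] [Algebra K R] {φ ψ : coneRing K →ₐ[K] R}
    (h : ∀ i, φ (coord K i) = ψ (coord K i)) : φ = ψ := by
  apply Ideal.Quotient.algHom_ext
  apply MvPolynomial.algHom_ext
  exact h

/-- The character values at the point `(t₁, t₂)` of the torus. -/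
def torusHom (t₁ t₂ : Kˣ) : AddMonoidAlgebra K (ℤ × ℤ) →ₐ[K] K :=
  AddMonoidAlgebra.lift K K (ℤ × ℤ)
    { toFun := fun w => ((t₁ ^ w.toAdd.1 * t₂ ^ w.toAdd.2 : Kˣ) : K)
      map_one' := by simp
      map_mul' := fun v w => by
        rw [← Units.val_mul, toAdd_mul, Prod.fst_add, Prod.snd_add, zpow_add, zpow_add,
          _root_.mul_mul_mul_comm] }

lemma torusHom_single (t₁ t₂ : Kˣ) (w : ℤ × ℤ) :
    torusHom t₁ t₂ (AddMonoidAlgebra.single w 1) = ((t₁ ^ w.1 * t₂ ^ w.2 : Kˣ) : K) := by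
  simp [torusHom]

lemma comor_smul {W : KScheme K} (g : W ⟶ torus K) (x : W ⟶ cone K) (i : Fin 4) :
    comor K (g • x) (coord K i) =
      comor K g (AddMonoidAlgebra.single (weight i) (1 : K)) * comor K x (coord K i) :=
  comor_act K g x i

lemma smul_affineMap_eq {R : Type u} [CommRing R] [Algebra K R] (θ : AddMonoidAlgebra K (ℤ × ℤ) →ₐ[K] R)
    {φ ψ : coneRing K →ₐ[K] R} (h : ∀ i, θ (AddMonoidAlgebra.single (weight i) (1 : K)) *
      φ (coord K i) = ψ (coord K i)) : affineMap K θ • affineMap K φ = affineMap K ψ := by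
  apply hom_ext_cone
  intro i
  rw [comor_smul, comor_affineMap, comor_affineMap, comor_affineMap, ← map_mul, h]

lemma mem_coneOpen_iff {R : Type u} [CommRing R] [Algebra K R] (φ : coneRing K →ₐ[K] R)
    (x : PrimeSpectrum R) : (affineMap K φ).left x ∈ coneOpen K ↔
      φ (coord K 1) * φ (coord K 2) ∉ x.asIdeal ∨ φ (coord K 0) * φ (coord K 3) ∉ x.asIdeal := by
  rw [← map_mul, ← map_mul]
  exact Iff.rfl

end Points

/-! ### The two curves through the vertex -/

section Unstable

variable {K : Type u} [Field K]

/-- The weight relation for a curve that runs generically in `coneOpen` and ends at the vertex: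
semistability supplies a section at the generic point, and the vertex, not being semistable, forces
that section to vanish there. -/
lemma exists_pow_eq_of_curve {L : LinearizedLineBundle (torus K) (cone K)}
    (hL : L.semistableLocus = (coneOpen K : Set (cone K).left))
    {φ : coneRing K →ₐ[K] PowerSeries K} {q : K} {θ : AddMonoidAlgebra K (ℤ × ℤ) →ₐ[K] K}
    (hθ : ∀ i, algebraMap K _ (θ (AddMonoidAlgebra.single (weight i) (1 : K))) *
      φ (coord K i) = PowerSeries.rescale q (φ (coord K i)))
    (hφ : φ (coord K 1) * φ (coord K 2) ≠ 0 ∨ φ (coord K 0) * φ (coord K 3) ≠ 0)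
    (hφ₀ : ∀ i, PowerSeries.constantCoeff (φ (coord K i)) = 0)
    {e₀ : affineScheme K K ⟶ L.total} (he₀ : L.IsFrame e₀)
    (hproj : e₀ ≫ L.proj = discOrigin K ≫ affineMap K φ) {a : K}
    (ha : affineMap K θ • e₀ = scalar K a • e₀) :
    ∃ n k : ℕ, 0 < n ∧ 0 < k ∧ a ^ n = q ^ k := by
  -- `⊥` is the generic point of the formal disc.
  have hx : (affineMap K φ).left (⊥ : PrimeSpectrum (PowerSeries K)) ∈ L.semistableLocus := by
    rw [hL]
    exact (mem_coneOpen_iff φ ⊥).2 hφ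
  obtain ⟨n, M, ν, s, V, hn, hν, hs, hV, hVa, hxV⟩ := hx
  obtain ⟨k, hk, hak⟩ := exists_pow_eq_of_isInvariantSection (q := q) (c := affineMap K φ)
    (g := affineMap K θ) hν hs (by
      rw [toSpec_eq_affineMap, affineMap_comp, discRescale, affineMap_comp]
      exact smul_affineMap_eq _ hθ) (by
      refine ⟨(⊥ : PrimeSpectrum K), ?_⟩
      -- Otherwise the same affine open set `V` would make the vertex semistable, although all
      -- coordinates vanish there.
      by_contra hne
      have hmem : (discOrigin K ≫ affineMap K φ).left (⊥ : PrimeSpectrum K) ∈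
          L.semistableLocus := by
        refine ⟨n, M, ν, s, V, hn, hν, hs, hV, hVa, ?_⟩
        rw [← SetLike.mem_coe, hV]
        intro hne'
        apply hne
        rw [← Category.assoc]
        exact hne'
      rw [hL, discOrigin, affineMap_comp] at hmem
      refine ((mem_coneOpen_iff _ _).1 hmem).elim ?_ ?_ <;>
      · intro h
        apply h
        simp [constantCoeffAlgHom_apply, hφ₀]) ⟨_, by
        rw [← SetLike.mem_coe, hV] at hxV
        exact hxV⟩ he₀ hproj ha
  exact ⟨n, k, hn, hk, hak⟩

/-- No linearized line bundle on the cone has the open set `coneOpen` as set of semistable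
points. -/
theorem semistableLocus_ne_coneOpen [CharZero K] (L : LinearizedLineBundle (torus K) (cone K)) :
    L.semistableLocus ≠ (coneOpen K : Set (cone K).left) := by
  intro hL
  let two : Kˣ := Units.mk0 2 two_ne_zero
  -- This is λ(2) for λ(s) = (s⁻¹, s²); it multiplies z₁, z₂, z₃, z₄ by 2⁻², 2³, 2, 2⁻⁴.
  let θ := torusHom (two⁻¹) (two ^ 2)
  -- The exponents are the absolute values of these weights, so `θ` acts on the curve `φ₁` as t ↦ 2t
  -- and on `φ₂` as t ↦ t/2.
  let φ₁ : coneRing K →ₐ[K] PowerSeries K :=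
    coneHom ![0, PowerSeries.X ^ 3, PowerSeries.X, 0] (by simp)
  let φ₂ : coneRing K →ₐ[K] PowerSeries K :=
    coneHom ![PowerSeries.X ^ 2, 0, 0, PowerSeries.X ^ 4] (by simp)
  have h12 : discOrigin K ≫ affineMap K φ₁ = discOrigin K ≫ affineMap K φ₂ := by
    rw [discOrigin, affineMap_comp, affineMap_comp]
    congr 1
    apply coneRing_algHom_ext
    intro i
    fin_cases i <;> simp [φ₁, φ₂, coneHom_coord, constantCoeffAlgHom_apply]
  have hfix : affineMap K θ • (discOrigin K ≫ affineMap K φ₁) =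
      discOrigin K ≫ affineMap K φ₁ := by
    rw [discOrigin, affineMap_comp]
    apply smul_affineMap_eq
    intro i
    fin_cases i <;> simp [φ₁, coneHom_coord, constantCoeffAlgHom_apply]
  -- One frame over the common limit point serves both curves, so that both relations concern the
  -- same scalar `a`.
  obtain ⟨e₀, hproj, he₀⟩ := L.exists_isFrame_of_local (discOrigin K ≫ affineMap K φ₁)
  obtain ⟨a', ha'⟩ := he₀.exists_smul_eq (e' := affineMap K θ • e₀) (by
    rw [L.smul_proj_eq, hproj, hfix])
  obtain ⟨a, rfl⟩ := exists_scalar_eq a'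
  have hresc (q r : K) (m : ℕ) (h : r = q ^ m) :
      algebraMap K (PowerSeries K) r * PowerSeries.X ^ m =
        PowerSeries.rescale q (PowerSeries.X ^ m : PowerSeries K) := by
    rw [map_pow, PowerSeries.rescale_X, mul_pow, h, map_pow]
    rfl
  obtain ⟨n, k, hn, hk, h1⟩ := exists_pow_eq_of_curve (q := 2) (φ := φ₁) hL (fun i => by
    fin_cases i
    · simp [φ₁, coneHom_coord]
    · simp only [φ₁, coneHom_coord]
      apply hresc
      simp [θ, torusHom_single, weight, two]
      norm_num
    · simp only [φ₁, coneHom_coord]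
      -- The entry is `X` itself, which has to be read as `X ^ 1`.
      convert! hresc 2 _ 1 _ using 2
      · simp
      · simp
      · simp [θ, torusHom_single, weight, two]
        norm_num
    · simp [φ₁, coneHom_coord]) (by simp [φ₁, coneHom_coord])
    (fun i => by fin_cases i <;> simp [φ₁, coneHom_coord]) he₀ hproj ha'.symm
  obtain ⟨m, l, hm, hl, h2⟩ := exists_pow_eq_of_curve (q := 2⁻¹) (φ := φ₂) hL (fun i => by
    fin_cases i
    · simp only [φ₂, coneHom_coord]
      apply hresc
      simp [θ, torusHom_single, weight, two]
    · simp [φ₂, coneHom_coord]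
    · simp [φ₂, coneHom_coord]
    · simp only [φ₂, coneHom_coord]
      apply hresc
      simp [θ, torusHom_single, weight, two]
      norm_num)
    (by simp [φ₂, coneHom_coord]) (fun i => by fin_cases i <;> simp [φ₂, coneHom_coord]) he₀
    (hproj.trans h12) ha'.symm
  -- Elimination of `a`: 2^(km) = a^(nm) = 2^(-ln).
  have h3 : (2 : K) ^ (k * m + l * n) = 1 := by
    rw [pow_add, pow_mul, ← h1, ← pow_mul, mul_comm n m, pow_mul, h2, ← pow_mul, ← mul_pow,
      inv_mul_cancel₀ two_ne_zero, one_pow]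
  have h4 : (2 : ℕ) ^ (k * m + l * n) = 1 := by exact_mod_cast h3
  rw [Nat.pow_eq_one] at h4
  have : 0 < k * m := Nat.mul_pos hk hm
  omega

end Unstable

end ConeGIT

end

noncomputable section

namespace ConeGIT

/-! ### Coordinate rings of the charts of the projective line -/

section ProjectiveLine

attribute [local instance] MvPolynomial.gradedAlgebra

open HomogeneousLocalization

variable (K : Type u) [Field K]

lemma X_mem_homogeneousSubmodule (i : Fin 2) :
    (MvPolynomial.X i : MvPolynomial (Fin 2) K) ∈ MvPolynomial.homogeneousSubmodule (Fin 2) K 1 :=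
  MvPolynomial.isHomogeneous_X K i

/-- The ring of functions on the standard chart `xᵢ ≠ 0` of the projective line. -/
abbrev chartRing (i : Fin 2) : Type u :=
  Away (MvPolynomial.homogeneousSubmodule (Fin 2) K) (MvPolynomial.X i)

/-- The function `xⱼ / xᵢ`. -/
abbrev chartRatio (i j : Fin 2) : chartRing K i :=
  Away.isLocalizationElem (X_mem_homogeneousSubmodule K i) (X_mem_homogeneousSubmodule K j)

/-- The constant functions on a chart. -/
def chartConst (i : Fin 2) : K →+* chartRing K i :=
  (fromZeroRingHom (MvPolynomial.homogeneousSubmodule (Fin 2) K) _).comp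
    (algebraMap K (MvPolynomial.homogeneousSubmodule (Fin 2) K 0))

/-- The homomorphism from the polynomial ring to the functions on a chart that maps the variable to
`xⱼ / xᵢ`. -/
def chartHom (i j : Fin 2) : Polynomial K →+* chartRing K i :=
  Polynomial.eval₂RingHom (chartConst K i) (chartRatio K i j)

variable {K}

/-- The localization homomorphism that inverts `xᵢ`. -/
abbrev invertX (i : Fin 2) : MvPolynomial (Fin 2) K →+*
    Localization.Away (MvPolynomial.X i : MvPolynomial (Fin 2) K) :=
  algebraMap _ _

lemma val_chartConst (i : Fin 2) (r : K) :
    (chartConst K i r).val = invertX i (MvPolynomial.C r) :=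
  (Localization.mk_one_eq_algebraMap _)

lemma X_mul_val_chartRatio (i j : Fin 2) :
    invertX i (MvPolynomial.X i) * (chartRatio K i j).val = invertX i (MvPolynomial.X j) := by
  rw [Away.val_mk, Localization.mk_eq_mk', mul_comm]
  simp

/-- Dehomogenization with respect to `xᵢ`. -/
def dehomogenize (i : Fin 2) : MvPolynomial (Fin 2) K →ₐ[K] Polynomial K :=
  MvPolynomial.aeval fun k => if k = i then 1 else Polynomial.X

/-- The identity a = xᵢⁿ · a(1, xⱼ/xᵢ) for a form a of degree n, checked on monomials. -/
lemma chartHom_dehomogenize {i j : Fin 2} (hij : i ≠ j) {n : ℕ} {a : MvPolynomial (Fin 2) K}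
    (ha : a ∈ MvPolynomial.homogeneousSubmodule (Fin 2) K n) :
    invertX i (MvPolynomial.X i) ^ n * (chartHom K i j (dehomogenize i a)).val =
      invertX i a := by
  let ψ : MvPolynomial (Fin 2) K →+* Localization.Away (MvPolynomial.X i : MvPolynomial (Fin 2) K) :=
    ((algebraMap (chartRing K i) _).comp (chartHom K i j)).comp (dehomogenize i).toRingHom
  have hC (r : K) : ψ (MvPolynomial.C r) = invertX i (MvPolynomial.C r) := by
    change (chartHom K i j (dehomogenize i (MvPolynomial.C r))).val = _
    have : dehomogenize i (MvPolynomial.C r) = Polynomial.C r := by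
      simp [dehomogenize]
    rw [this, chartHom, Polynomial.coe_eval₂RingHom, Polynomial.eval₂_C, val_chartConst]
  have hX (k : Fin 2) : invertX i (MvPolynomial.X i) * ψ (MvPolynomial.X k) =
      invertX i (MvPolynomial.X k) := by
    change _ * (chartHom K i j (dehomogenize i (MvPolynomial.X k))).val = _
    rw [dehomogenize, MvPolynomial.aeval_X]
    split_ifs with hk
    · rw [map_one, HomogeneousLocalization.val_one, _root_.mul_one, hk]
    · have hkj : k = j := by omega
      rw [chartHom, Polynomial.coe_eval₂RingHom, Polynomial.eval₂_X, X_mul_val_chartRatio, hkj]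
  change _ * ψ a = _
  rw [a.as_sum, map_sum, map_sum, Finset.mul_sum]
  refine Finset.sum_congr rfl fun m hm => ?_
  have hdeg : m.sum (fun _ e => e) = n := by
    rw [← (MvPolynomial.mem_homogeneousSubmodule n a).1 ha (MvPolynomial.mem_support_iff.1 hm)]
    simp [Finsupp.weight_apply]
  rw [MvPolynomial.monomial_eq, map_mul, map_mul, hC, mul_left_comm]
  congr 1
  rw [← hdeg, Finsupp.prod, Finsupp.sum, map_prod, map_prod, ← Finset.prod_pow_eq_pow_sum,
    ← Finset.prod_mul_distrib]
  refine Finset.prod_congr rfl fun k _ => ?_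
  rw [map_pow, map_pow, ← mul_pow, hX]

lemma chartHom_bijective {i j : Fin 2} (hij : i ≠ j) : Function.Bijective (chartHom K i j) := by
  constructor
  -- Dehomogenization sends xᵢ to 1, hence extends to the localization, where it gives a left
  -- inverse.
  · have hu : IsUnit ((dehomogenize i).toRingHom (MvPolynomial.X i : MvPolynomial (Fin 2) K)) := by
      simp [dehomogenize]
    let l : Localization.Away (MvPolynomial.X i : MvPolynomial (Fin 2) K) →+* Polynomial K :=
      IsLocalization.Away.lift (MvPolynomial.X i) hu
    have hl (a : MvPolynomial (Fin 2) K) : l (invertX i a) = dehomogenize i a :=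
      IsLocalization.Away.lift_eq _ hu a
    have h : (l.comp (algebraMap (chartRing K i) _)).comp (chartHom K i j) = RingHom.id _ := by
      apply Polynomial.ringHom_ext
      · intro r
        change l (chartHom K i j (Polynomial.C r)).val = _
        rw [chartHom, Polynomial.coe_eval₂RingHom, Polynomial.eval₂_C, val_chartConst, hl]
        simp [dehomogenize]
      · change l (chartHom K i j Polynomial.X).val = _
        rw [chartHom, Polynomial.coe_eval₂RingHom, Polynomial.eval₂_X]
        have h1 := congr(l $(X_mul_val_chartRatio (K := K) i j))
        rw [map_mul, hl, hl, dehomogenize, MvPolynomial.aeval_X, MvPolynomial.aeval_X, if_pos rfl,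
          if_neg hij.symm, _root_.one_mul] at h1
        exact h1
    intro p q hpq
    have hp := congr($h p)
    have hq := congr($h q)
    rw [RingHom.comp_apply] at hp hq
    rw [hpq, hq] at hp
    exact hp.symm
  · intro x
    obtain ⟨n, a, ha, rfl⟩ := Away.mk_surjective _ (X_mem_homogeneousSubmodule K i) x
    refine ⟨dehomogenize i a, ?_⟩
    apply HomogeneousLocalization.val_injective
    rw [Away.val_mk, Localization.mk_eq_mk', IsLocalization.eq_mk'_iff_mul_eq, mul_comm, map_pow]
    exact chartHom_dehomogenize hij (by simpa using ha)

variable (K) in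
/-- The functions on a chart of the projective line form a polynomial ring. -/
def chartEquiv {i j : Fin 2} (hij : i ≠ j) : Polynomial K ≃+* chartRing K i :=
  RingEquiv.ofBijective (chartHom K i j) (chartHom_bijective hij)

end ProjectiveLine

end ConeGIT

end

noncomputable section

namespace ConeGIT

/-! ### Charts of the projective line and their overlap -/

section Charts

attribute [local instance] MvPolynomial.gradedAlgebra

open HomogeneousLocalization

variable (K : Type u) [Field K]

/-- The standard open subset `xᵢ ≠ 0` of the projective line. -/
def chartOpen (i : Fin 2) : (projectiveLine K).left.Opens :=
  Proj.basicOpen (MvPolynomial.homogeneousSubmodule (Fin 2) K) (MvPolynomial.X i)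

lemma isAffineOpen_chartOpen (i : Fin 2) : IsAffineOpen (chartOpen K i) :=
  Proj.isAffineOpen_basicOpen _ _ (X_mem_homogeneousSubmodule K i) one_pos

lemma iSup_chartOpen : ⨆ i, chartOpen K i = ⊤ := by
  refine Proj.iSup_basicOpen_eq_top' (MvPolynomial.homogeneousSubmodule (Fin 2) K)
    MvPolynomial.X (fun i => ⟨1, X_mem_homogeneousSubmodule K i⟩) ?_
  rw [eq_top_iff]
  intro p _
  induction p using MvPolynomial.induction_on with
  | C a =>
    exact Subalgebra.algebraMap_mem _
      (algebraMap K (MvPolynomial.homogeneousSubmodule (Fin 2) K 0) a)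
  | add p q hp hq => exact add_mem (hp trivial) (hq trivial)
  | mul_X p i hp => exact mul_mem (hp trivial) (Algebra.subset_adjoin ⟨i, rfl⟩)

/-- The open immersion of a chart of the projective line, as a morphism of schemes. -/
def chartMap {i j : Fin 2} (hij : i ≠ j) : Spec (CommRingCat.of (Polynomial K)) ⟶
    Proj (MvPolynomial.homogeneousSubmodule (Fin 2) K) :=
  Spec.map (CommRingCat.ofHom (chartEquiv K hij).symm.toRingHom) ≫
    Proj.awayι _ _ (X_mem_homogeneousSubmodule K i) one_pos

lemma chartMap_toSpec {i j : Fin 2} (hij : i ≠ j) : chartMap K hij ≫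
    Proj.toSpecZero (MvPolynomial.homogeneousSubmodule (Fin 2) K) ≫
    Spec.map (CommRingCat.ofHom
      (algebraMap K (MvPolynomial.homogeneousSubmodule (Fin 2) K 0))) =
    Spec.map (CommRingCat.ofHom (algebraMap K (Polynomial K))) := by
  rw [chartMap, Category.assoc, Proj.awayι_toSpecZero_assoc, ← Spec.map_comp, ← Spec.map_comp]
  congr 1
  refine CommRingCat.hom_ext (RingHom.ext fun r => ?_)
  change (chartEquiv K hij).symm (chartConst K i r) = Polynomial.C r
  rw [RingEquiv.symm_apply_eq]
  exact (Polynomial.eval₂_C _ _).symm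

instance chartEquiv_isIso {i j : Fin 2} (hij : i ≠ j) :
    IsIso (CommRingCat.ofHom (chartEquiv K hij).symm.toRingHom) :=
  inferInstanceAs (IsIso (chartEquiv K hij).symm.toCommRingCatIso.hom)

instance chartMap_isOpenImmersion {i j : Fin 2} (hij : i ≠ j) :
    IsOpenImmersion (chartMap K hij) := by
  rw [chartMap]
  infer_instance

/-- A chart of the projective line. -/
def chart {i j : Fin 2} (hij : i ≠ j) : affineScheme K (Polynomial K) ⟶ projectiveLine K :=
  Over.homMk (chartMap K hij) (chartMap_toSpec K hij)

instance chart_isOpenImmersion {i j : Fin 2} (hij : i ≠ j) : IsOpenImmersion (chart K hij).left :=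
  chartMap_isOpenImmersion K hij

lemma opensRange_chartMap {i j : Fin 2} (hij : i ≠ j) : (chartMap K hij).opensRange =
    Proj.basicOpen (MvPolynomial.homogeneousSubmodule (Fin 2) K) (MvPolynomial.X i) :=
  (Scheme.Hom.opensRange_comp_of_isIso _ _).trans (Proj.opensRange_awayι _ _ _ _)

lemma range_chart {i j : Fin 2} (hij : i ≠ j) :
    Set.range (chart K hij).left = (chartOpen K i : Set (projectiveLine K).left) :=
  congrArg (fun V : (Proj (MvPolynomial.homogeneousSubmodule (Fin 2) K)).Opens =>
    (V : Set (Proj (MvPolynomial.homogeneousSubmodule (Fin 2) K)))) (opensRange_chartMap K hij)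

lemma chartMap_preimage {i j : Fin 2} (hij : i ≠ j) :
    chartMap K hij ⁻¹ᵁ Proj.basicOpen (MvPolynomial.homogeneousSubmodule (Fin 2) K)
      (MvPolynomial.X j) = PrimeSpectrum.basicOpen (Polynomial.X : Polynomial K) := by
  rw [chartMap, Scheme.Hom.comp_preimage]
  have h := Proj.awayι_preimage_basicOpen (MvPolynomial.homogeneousSubmodule (Fin 2) K)
    (X_mem_homogeneousSubmodule K i) one_pos (X_mem_homogeneousSubmodule K j) one_pos
  rw [h]
  change PrimeSpectrum.basicOpen ((chartEquiv K hij).symm (chartRatio K i j)) = _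
  congr 1
  rw [RingEquiv.symm_apply_eq]
  exact (Polynomial.eval₂_X _ _).symm

lemma chart_mem_chartOpen_iff {i j : Fin 2} (hij : i ≠ j) (x : PrimeSpectrum (Polynomial K)) :
    (chart K hij).left x ∈ chartOpen K j ↔ Polynomial.X ∉ x.asIdeal := by
  have h : x ∈ chartMap K hij ⁻¹ᵁ Proj.basicOpen (MvPolynomial.homogeneousSubmodule (Fin 2) K)
      (MvPolynomial.X j) ↔ x ∈ PrimeSpectrum.basicOpen (Polynomial.X : Polynomial K) := by
    rw [chartMap_preimage]
    rfl
  exact h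

/-- The ring of functions on the overlap of two charts. -/
abbrev overlapRing (i j : Fin 2) : Type u :=
  Away (MvPolynomial.homogeneousSubmodule (Fin 2) K) (MvPolynomial.X i * MvPolynomial.X j)

/-- Restriction of functions from the first chart to the overlap. -/
def overlapLeft (i j : Fin 2) : Polynomial K →+* overlapRing K i j :=
  (awayMap _ (X_mem_homogeneousSubmodule K j) rfl).comp (chartHom K i j)

/-- Restriction of functions from the second chart to the overlap. -/
def overlapRight (i j : Fin 2) : Polynomial K →+* overlapRing K i j :=
  (awayMap _ (X_mem_homogeneousSubmodule K i) (mul_comm _ _)).comp (chartHom K j i)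

lemma overlap_mul (i j : Fin 2) :
    overlapLeft K i j Polynomial.X * overlapRight K i j Polynomial.X = 1 := by
  rw [overlapLeft, overlapRight, RingHom.comp_apply, RingHom.comp_apply, chartHom, chartHom,
    Polynomial.coe_eval₂RingHom, Polynomial.coe_eval₂RingHom, Polynomial.eval₂_X,
    Polynomial.eval₂_X, awayMap_mk, awayMap_mk]
  apply HomogeneousLocalization.val_injective
  rw [HomogeneousLocalization.val_mul, HomogeneousLocalization.val_one, Away.val_mk, Away.val_mk,
    Localization.mk_mul, ← Localization.mk_one, Localization.mk_eq_mk_iff,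
    Localization.r_iff_exists]
  refine ⟨1, ?_⟩
  simp only [OneMemClass.coe_one, Submonoid.coe_mul]
  ring

lemma overlapLeft_chartMap {i j : Fin 2} (hij : i ≠ j) :
    Spec.map (CommRingCat.ofHom (overlapLeft K i j)) ≫ chartMap K hij =
      Proj.awayι _ _ (SetLike.mul_mem_graded (X_mem_homogeneousSubmodule K i)
        (X_mem_homogeneousSubmodule K j)) (by norm_num) := by
  rw [chartMap, ← Category.assoc, ← Spec.map_comp]
  have h : CommRingCat.ofHom (chartEquiv K hij).symm.toRingHom ≫
      CommRingCat.ofHom (overlapLeft K i j) =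
        CommRingCat.ofHom (awayMap _ (X_mem_homogeneousSubmodule K j) rfl) := by
    refine CommRingCat.hom_ext (RingHom.ext fun r => ?_)
    exact congrArg (awayMap _ (X_mem_homogeneousSubmodule K j) rfl)
      ((chartEquiv K hij).apply_symm_apply r)
  rw [h]
  exact Proj.SpecMap_awayMap_awayι _ _ _ _ _

lemma overlapRight_chartMap {i j : Fin 2} (hij : i ≠ j) :
    Spec.map (CommRingCat.ofHom (overlapRight K i j)) ≫ chartMap K hij.symm =
      Proj.awayι _ _ (SetLike.mul_mem_graded (X_mem_homogeneousSubmodule K i)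
        (X_mem_homogeneousSubmodule K j)) (by norm_num) := by
  rw [chartMap, ← Category.assoc, ← Spec.map_comp]
  have h : CommRingCat.ofHom (chartEquiv K hij.symm).symm.toRingHom ≫
      CommRingCat.ofHom (overlapRight K i j) =
        CommRingCat.ofHom (awayMap _ (X_mem_homogeneousSubmodule K i) (mul_comm _ _)) := by
    refine CommRingCat.hom_ext (RingHom.ext fun r => ?_)
    exact congrArg (awayMap _ (X_mem_homogeneousSubmodule K i) (mul_comm _ _))
      ((chartEquiv K hij.symm).apply_symm_apply r)
  rw [h]
  exact Proj.SpecMap_awayMap_awayι _ _ _ _ _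

/-- Where the coordinate xⱼ/xᵢ does not vanish, the image in the projective line lies in the basic
open set of xᵢxⱼ, the range of the open immersion of the overlap. -/
lemma exists_overlap_lift {i j : Fin 2} (hij : i ≠ j) {S : Scheme.{u}}
    (f : S ⟶ Spec (CommRingCat.of (Polynomial K)))
    (hf : ∀ x, Polynomial.X ∉ (f x).asIdeal) :
    ∃ k : S ⟶ Spec (CommRingCat.of (overlapRing K i j)),
      f = k ≫ Spec.map (CommRingCat.ofHom (overlapLeft K i j)) := by
  let r := Proj.awayι _ _ (SetLike.mul_mem_graded (X_mem_homogeneousSubmodule K i)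
    (X_mem_homogeneousSubmodule K j)) (by norm_num)
  have hr : Set.range (f ≫ chartMap K hij) ⊆ Set.range r := by
    have h1 : Set.range r = (Proj.basicOpen (MvPolynomial.homogeneousSubmodule (Fin 2) K)
        (MvPolynomial.X i * MvPolynomial.X j) :
          Set (Proj (MvPolynomial.homogeneousSubmodule (Fin 2) K))) :=
      congr(($(Proj.opensRange_awayι _ _ (SetLike.mul_mem_graded (X_mem_homogeneousSubmodule K i)
        (X_mem_homogeneousSubmodule K j)) (by norm_num)) :
          Set (Proj (MvPolynomial.homogeneousSubmodule (Fin 2) K))))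
    rw [h1, Proj.basicOpen_mul]
    rintro _ ⟨x, rfl⟩
    refine ⟨?_, ?_⟩
    · have h2 : chartMap K hij (f x) ∈ (chartMap K hij).opensRange := ⟨f x, rfl⟩
      rw [opensRange_chartMap] at h2
      exact h2
    · exact (chart_mem_chartOpen_iff K hij (f x)).2 (hf x)
  refine ⟨IsOpenImmersion.lift r (f ≫ chartMap K hij) hr, ?_⟩
  rw [← cancel_mono (chartMap K hij), Category.assoc, overlapLeft_chartMap]
  exact (IsOpenImmersion.lift_fac _ _ _).symm

lemma hom_ext_polynomial {W : KScheme K} {f g : W ⟶ affineScheme K (Polynomial K)}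
    (h : comor K f Polynomial.X = comor K g Polynomial.X) : f = g :=
  comor_inj K (Polynomial.ringHom_ext (fun r => comor_algebraMap K f g r) h)

lemma preimage_basicOpen_comor {A : Type u} [CommRing A] [Algebra K A] {W : KScheme K}
    (f : W ⟶ affineScheme K A) (a : A) :
    f.left ⁻¹ᵁ (PrimeSpectrum.basicOpen a : TopologicalSpace.Opens (PrimeSpectrum A)) =
      W.left.basicOpen (comor K f a) := by
  have key {S : Scheme.{u}} (g : S ⟶ Spec (.of A)) : g ⁻¹ᵁ PrimeSpectrum.basicOpen a =
      S.basicOpen (((Scheme.ΓSpecIso (.of A)).inv ≫ g.appTop).hom a) :=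
    (congrArg (g ⁻¹ᵁ ·) (basicOpen_eq_of_affine (R := .of A) a).symm).trans
      (Scheme.preimage_basicOpen_top g _)
  exact key f.left

lemma notMem_of_isUnit_comor {A : Type u} [CommRing A] [Algebra K A] {W : KScheme K}
    (f : W ⟶ affineScheme K A) {a : A} (h : IsUnit (comor K f a)) (x : W.left) :
    a ∉ (show PrimeSpectrum A from f.left x).asIdeal := by
  have hx : x ∈ f.left ⁻¹ᵁ (PrimeSpectrum.basicOpen a : TopologicalSpace.Opens (PrimeSpectrum A)) := by
    rw [preimage_basicOpen_comor, Scheme.basicOpen_of_isUnit _ h]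
    trivial
  exact hx

/-- Two points in different charts agree if their coordinates are inverse to each other. -/
theorem comp_chart_eq {i j : Fin 2} (hij : i ≠ j) {W : KScheme K}
    (f g : W ⟶ affineScheme K (Polynomial K))
    (h : comor K f Polynomial.X * comor K g Polynomial.X = 1) :
    f ≫ chart K hij = g ≫ chart K hij.symm := by
  obtain ⟨k, hk⟩ := exists_overlap_lift K hij f.left
    (notMem_of_isUnit_comor K f (IsUnit.of_mul_eq_one _ h))
  have hk' : (k ≫ Spec.map (CommRingCat.ofHom (overlapRight K i j))) ≫ chartMap K hij.symm =
      (f ≫ chart K hij).left := by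
    rw [Category.assoc, overlapRight_chartMap K hij, ← overlapLeft_chartMap K hij,
      ← Category.assoc, ← hk]
    rfl
  -- The point `k` of the overlap as read in the second chart. It remains to see that it is `g`:
  -- both coordinates are inverse to that of `f`.
  let g' : W ⟶ affineScheme K (Polynomial K) :=
    Over.homMk (k ≫ Spec.map (CommRingCat.ofHom (overlapRight K i j))) (by
      rw [← Over.w (f ≫ chart K hij), ← hk', ← Over.w (chart K hij.symm)]
      rfl)
  have hg' : g' ≫ chart K hij.symm = f ≫ chart K hij := by
    ext1
    exact hk'
  rw [← hg']
  congr 1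
  apply hom_ext_polynomial
  have key (φ : Polynomial K →+* overlapRing K i j) :
      (Scheme.ΓSpecIso (.of (Polynomial K))).inv ≫ (k ≫ Spec.map (CommRingCat.ofHom φ)).appTop =
        CommRingCat.ofHom φ ≫ (Scheme.ΓSpecIso (.of (overlapRing K i j))).inv ≫ k.appTop := by
    rw [Scheme.Hom.comp_appTop,
      reassoc_of% Scheme.ΓSpecIso_inv_naturality (CommRingCat.ofHom φ)]
  let τ := ((Scheme.ΓSpecIso (.of (overlapRing K i j))).inv ≫ k.appTop).hom
  have h1 : comor K g' Polynomial.X = τ (overlapRight K i j Polynomial.X) :=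
    congr(($(key (overlapRight K i j))).hom Polynomial.X)
  have h2 : comor K f Polynomial.X = τ (overlapLeft K i j Polynomial.X) := by
    have h3 : comor K f Polynomial.X = ((Scheme.ΓSpecIso (.of (Polynomial K))).inv ≫
        (k ≫ Spec.map (CommRingCat.ofHom (overlapLeft K i j))).appTop).hom Polynomial.X := by
      rw [← hk]
      rfl
    exact h3.trans congr(($(key (overlapLeft K i j))).hom Polynomial.X)
  refine left_inv_eq_right_inv (a := comor K f Polynomial.X) ?_ h
  rw [h1, h2]
  exact (map_mul τ _ _).symm.trans ((congrArg τ ((mul_comm _ _).trans (overlap_mul K i j))).trans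
    (map_one τ))

end Charts

end ConeGIT

end

noncomputable section

namespace ConeGIT

/-! ### Restriction and pullback of functions -/

section Sections

variable {X Y Z : Scheme.{u}}

/-- Restriction of functions. -/
def res {U V : X.Opens} (h : V ≤ U) : Γ(X, U) →+* Γ(X, V) := (X.presheaf.map (homOfLE h).op).hom

/-- Pullback of functions. -/
def pull (f : X ⟶ Y) (U : Y.Opens) (V : X.Opens) (e : V ≤ f ⁻¹ᵁ U) : Γ(Y, U) →+* Γ(X, V) :=
  (f.appLE U V e).hom

lemma res_res {U V W : X.Opens} (h : V ≤ U) (h' : W ≤ V) (x : Γ(X, U)) :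
    res h' (res h x) = res (h'.trans h) x :=
  congr(($((X.presheaf.map_comp (homOfLE h).op (homOfLE h').op).symm)).hom x)

lemma pull_res (f : X ⟶ Y) {U U' : Y.Opens} {V : X.Opens} (h : U' ≤ U) (e : V ≤ f ⁻¹ᵁ U')
    (x : Γ(Y, U)) : pull f U' V e (res h x) = pull f U V (e.trans (f.preimage_mono h)) x :=
  congr(($(f.map_appLE e (homOfLE h).op)).hom x)

lemma res_pull (f : X ⟶ Y) {U : Y.Opens} {V V' : X.Opens} (h : V' ≤ V) (e : V ≤ f ⁻¹ᵁ U)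
    (x : Γ(Y, U)) : res h (pull f U V e x) = pull f U V' (h.trans e) x :=
  congr(($(f.appLE_map e (homOfLE h).op)).hom x)

lemma pull_pull (f : X ⟶ Y) (g : Y ⟶ Z) {U : Z.Opens} {V : Y.Opens} {W : X.Opens}
    (e : V ≤ g ⁻¹ᵁ U) (e' : W ≤ f ⁻¹ᵁ V) (x : Γ(Z, U)) :
    pull f V W e' (pull g U V e x) = pull (f ≫ g) U W (e'.trans (f.preimage_mono e)) x :=
  congr(($(Scheme.Hom.appLE_comp_appLE f g U V W e e')).hom x)

lemma pull_congr {f g : X ⟶ Y} (h : f = g) {U : Y.Opens} {V : X.Opens} (e : V ≤ f ⁻¹ᵁ U)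
    (e' : V ≤ g ⁻¹ᵁ U) (x : Γ(Y, U)) : pull f U V e x = pull g U V e' x := by
  subst h
  rfl

lemma app_eq_pull (f : X ⟶ Y) (U : Y.Opens) (x : Γ(Y, U)) : f.app U x = pull f U _ le_rfl x :=
  congr(($(f.app_eq_appLE)).hom x)

lemma eq_of_res_eq {I : Type*} {U : I → X.Opens} {V : X.Opens} (h : ∀ i, U i ≤ V)
    (hV : V ≤ iSup U) {x y : Γ(X, V)} (hxy : ∀ i, res (h i) x = res (h i) y) : x = y :=
  X.sheaf.eq_of_locally_eq' U V (fun i => homOfLE (h i)) hV x y hxy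

lemma exists_res_eq {I : Type*} {U : I → X.Opens} {V : X.Opens} (h : ∀ i, U i ≤ V)
    (hV : V ≤ iSup U) (x : ∀ i, Γ(X, U i))
    (hx : ∀ i j, res (inf_le_left : U i ⊓ U j ≤ U i) (x i) = res inf_le_right (x j)) :
    ∃ y : Γ(X, V), ∀ i, res (h i) y = x i :=
  (X.sheaf.existsUnique_gluing' U V (fun i => homOfLE (h i)) hV x hx).exists

lemma isUnit_res_basicOpen {U V : X.Opens} (b : Γ(X, U)) (h : V ≤ U) (hV : V ≤ X.basicOpen b) :
    IsUnit (res h b) := by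
  have h1 := (X.toRingedSpace.isUnit_res_basicOpen b).map (res hV)
  have h2 : res hV (res (X.basicOpen_le b) b) = res h b := res_res _ _ _
  rw [← h2]
  exact h1

lemma exists_mul_eq_res {U V : X.Opens} (hU : IsAffineOpen U) (b : Γ(X, U)) (h : V ≤ U)
    (hV : V = X.basicOpen b) (x : Γ(X, V)) :
    ∃ (n : ℕ) (r : Γ(X, U)), x * res h b ^ n = res h r := by
  let := (X.presheaf.map (homOfLE h).op).hom.toAlgebra
  have hloc := hU.isLocalization_of_eq_basicOpen b (homOfLE h) hV
  obtain ⟨n, r, hr⟩ := IsLocalization.Away.surj b x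
  exact ⟨n, r, hr⟩

lemma exists_pow_mul_eq_zero {U V : X.Opens} (hU : IsCompact (U : Set X)) (x b : Γ(X, U))
    (h : V ≤ U) (hV : V = X.basicOpen b) (hx : res h x = 0) : ∃ n : ℕ, b ^ n * x = 0 := by
  subst hV
  exact exists_pow_mul_eq_zero_of_res_basicOpen_eq_zero_of_isCompact X hU x b hx

end Sections

/-! ### Descent of functions along a quotient map -/

section Descent

variable {X Y Z : Scheme.{u}} (o₁ o₂ : Z ⟶ X) (p : X ⟶ Y)

/-- The pullbacks of a function along two morphisms agree. -/
def IsEqualized {U : X.Opens} (f : Γ(X, U)) : Prop :=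
  pull o₁ U (o₁ ⁻¹ᵁ U ⊓ o₂ ⁻¹ᵁ U) inf_le_left f = pull o₂ U (o₁ ⁻¹ᵁ U ⊓ o₂ ⁻¹ᵁ U) inf_le_right f

/-- The functions on `V` are exactly the functions on its preimage on which `o₁` and `o₂` agree. -/
def DescendsOver (V : Y.Opens) : Prop :=
  Function.Injective (pull p V (p ⁻¹ᵁ V) le_rfl) ∧
    ∀ f : Γ(X, p ⁻¹ᵁ V), IsEqualized o₁ o₂ f → ∃ h, pull p V (p ⁻¹ᵁ V) le_rfl h = f

variable {o₁ o₂ p}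

lemma IsEqualized.pull_eq {U : X.Opens} {f : Γ(X, U)} (hf : IsEqualized o₁ o₂ f) {W : Z.Opens}
    (e₁ : W ≤ o₁ ⁻¹ᵁ U) (e₂ : W ≤ o₂ ⁻¹ᵁ U) : pull o₁ U W e₁ f = pull o₂ U W e₂ f := by
  have h := congr(res (le_inf e₁ e₂) $hf)
  rwa [res_pull, res_pull] at h

lemma IsEqualized.res {U U' : X.Opens} {f : Γ(X, U)} (hf : IsEqualized o₁ o₂ f) (h : U' ≤ U) :
    IsEqualized o₁ o₂ (res h f) := by
  rw [IsEqualized, pull_res, pull_res]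
  exact hf.pull_eq _ _

lemma isEqualized_pull (hp : o₁ ≫ p = o₂ ≫ p) (V : Y.Opens) (h : Γ(Y, V)) :
    IsEqualized o₁ o₂ (pull p V (p ⁻¹ᵁ V) le_rfl h) := by
  rw [IsEqualized, pull_pull, pull_pull]
  exact pull_congr hp _ _ _

/-- Equalizers commute with localization at a function from the base: such a function is itself
equalized, so a denominator may be cleared, the numerator descended, and the denominator put back.
-/
lemma DescendsOver.basicOpen (hp : o₁ ≫ p = o₂ ≫ p) {V : Y.Opens} (hV : IsAffineOpen V)
    (hU : IsAffineOpen (p ⁻¹ᵁ V))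
    (hW : IsCompact ((o₁ ⁻¹ᵁ (p ⁻¹ᵁ V) ⊓ o₂ ⁻¹ᵁ (p ⁻¹ᵁ V) : Z.Opens) : Set Z))
    (h : DescendsOver o₁ o₂ p V) (b : Γ(Y, V)) : DescendsOver o₁ o₂ p (Y.basicOpen b) := by
  have hD : Y.basicOpen b ≤ V := Y.basicOpen_le b
  have hpD : p ⁻¹ᵁ Y.basicOpen b ≤ p ⁻¹ᵁ V := p.preimage_mono hD
  set b' := pull p V (p ⁻¹ᵁ V) le_rfl b with hb'
  have hpb : p ⁻¹ᵁ Y.basicOpen b = X.basicOpen b' := by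
    rw [hb', ← app_eq_pull, Scheme.preimage_basicOpen]
  have hub : IsUnit (ConeGIT.res hD b) := isUnit_res_basicOpen b hD le_rfl
  have hub' : IsUnit (ConeGIT.res hpD b') := isUnit_res_basicOpen b' hpD hpb.le
  have hpr (r : Γ(Y, V)) : pull p (Y.basicOpen b) (p ⁻¹ᵁ Y.basicOpen b) le_rfl
      (ConeGIT.res hD r) = ConeGIT.res hpD (pull p V (p ⁻¹ᵁ V) le_rfl r) := by
    rw [pull_res, res_pull]
  constructor
  · rw [injective_iff_map_eq_zero]
    intro x hx
    obtain ⟨n, r, hr⟩ := exists_mul_eq_res hV b hD rfl x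
    have h1 := congr(pull p (Y.basicOpen b) (p ⁻¹ᵁ Y.basicOpen b) le_rfl $hr)
    rw [map_mul, hx, zero_mul, hpr] at h1
    obtain ⟨m, hm⟩ := exists_pow_mul_eq_zero hU.isCompact _ b' hpD hpb h1.symm
    rw [hb', ← map_pow, ← map_mul] at hm
    have h2 := (injective_iff_map_eq_zero _).1 h.1 _ hm
    have h3 := congr(ConeGIT.res hD $h2)
    rw [map_mul, map_pow, map_zero, (hub.pow m).mul_right_eq_zero, ← hr,
      (hub.pow n).mul_left_eq_zero] at h3
    exact h3
  · intro f hf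
    obtain ⟨n, r, hr⟩ := exists_mul_eq_res hU b' hpD hpb f
    let W : Z.Opens := o₁ ⁻¹ᵁ (p ⁻¹ᵁ V) ⊓ o₂ ⁻¹ᵁ (p ⁻¹ᵁ V)
    have hbeq : pull o₁ (p ⁻¹ᵁ V) W inf_le_left b' = pull o₂ (p ⁻¹ᵁ V) W inf_le_right b' :=
      isEqualized_pull hp V b
    let β := pull o₁ (p ⁻¹ᵁ V) W inf_le_left b'
    have hβ : Z.basicOpen β = W ⊓ o₁ ⁻¹ᵁ (p ⁻¹ᵁ Y.basicOpen b) := by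
      rw [hpb]
      exact Scheme.basicOpen_appLE _ _ _ _ _
    have hβ₂ : Z.basicOpen β = W ⊓ o₂ ⁻¹ᵁ (p ⁻¹ᵁ Y.basicOpen b) := by
      rw [hpb]
      change Z.basicOpen (pull o₁ (p ⁻¹ᵁ V) W inf_le_left b') = _
      rw [hbeq]
      exact Scheme.basicOpen_appLE _ _ _ _ _
    have e₁ : Z.basicOpen β ≤ o₁ ⁻¹ᵁ (p ⁻¹ᵁ Y.basicOpen b) := hβ.le.trans inf_le_right
    have e₂ : Z.basicOpen β ≤ o₂ ⁻¹ᵁ (p ⁻¹ᵁ Y.basicOpen b) := hβ₂.le.trans inf_le_right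
    -- The numerator `r` is equalized only after restriction to the locus where `b` is invertible.
    have hrD : IsEqualized o₁ o₂ (ConeGIT.res hpD r) := by
      rw [← hr, IsEqualized, map_mul, map_mul, map_pow, map_pow, hf.pull_eq _ inf_le_right]
      congr 2
      exact ((isEqualized_pull hp V b).res hpD).pull_eq _ _
    have hd : ConeGIT.res (Z.basicOpen_le β) (pull o₁ (p ⁻¹ᵁ V) W inf_le_left r -
        pull o₂ (p ⁻¹ᵁ V) W inf_le_right r) = 0 := by
      have h1 := hrD.pull_eq e₁ e₂
      rw [pull_res, pull_res] at h1
      rw [map_sub, res_pull, res_pull, h1, sub_self]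
    -- By compactness of `W` a further power of `b` kills the difference of the two pullbacks of `r`
    -- on all of `W`; hence the total denominator `b ^ (n + m)` below.
    obtain ⟨m, hm⟩ := exists_pow_mul_eq_zero hW _ β (Z.basicOpen_le β) rfl hd
    have hr' : IsEqualized o₁ o₂ (b' ^ m * r) := by
      rw [IsEqualized, map_mul, map_mul, map_pow, map_pow, ← hbeq, ← sub_eq_zero, ← mul_sub]
      exact hm
    obtain ⟨g, hg⟩ := h.2 _ hr'
    obtain ⟨c, hc⟩ := (hub.pow (n + m)).exists_right_inv
    refine ⟨ConeGIT.res hD g * c, ?_⟩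
    have hc' := congr(pull p (Y.basicOpen b) (p ⁻¹ᵁ Y.basicOpen b) le_rfl $hc)
    rw [map_mul, map_pow, map_one, hpr, ← hb', pow_add] at hc'
    rw [map_mul, hpr, hg, map_mul, map_pow, ← hr]
    linear_combination f * hc'

/-- The sheaf property on source and target. Injectivity on every open set is shown first, since it
makes the local descents agree on overlaps. -/
lemma descendsOver_of_locally
    (h : ∀ (V : Y.Opens) (y : Y), y ∈ V → ∃ D : Y.Opens, y ∈ D ∧ D ≤ V ∧ DescendsOver o₁ o₂ p D)
    (V : Y.Opens) : DescendsOver o₁ o₂ p V := by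
  have hinj (V : Y.Opens) : Function.Injective (pull p V (p ⁻¹ᵁ V) le_rfl) := by
    choose D hyD hDV hD using fun y : V => h V y y.2
    intro s t hst
    refine eq_of_res_eq hDV (fun y hy => TopologicalSpace.Opens.mem_iSup.2 ⟨⟨y, hy⟩, hyD _⟩)
      fun y => (hD y).1 ?_
    have h1 := congr(ConeGIT.res (p.preimage_mono (hDV y)) $hst)
    rw [res_pull, res_pull] at h1
    rw [pull_res, pull_res, h1]
  refine ⟨hinj V, fun f hf => ?_⟩
  choose D hyD hDV hD using fun y : V => h V y y.2
  choose g hg using fun y => (hD y).2 _ (hf.res (p.preimage_mono (hDV y)))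
  have hV : V ≤ iSup D := fun y hy => TopologicalSpace.Opens.mem_iSup.2 ⟨⟨y, hy⟩, hyD _⟩
  have hglue (x y : V) (E : Y.Opens) (hx : E ≤ D x) (hy : E ≤ D y) :
      ConeGIT.res hx (g x) = ConeGIT.res hy (g y) := by
    apply hinj
    have h1 := congr(ConeGIT.res (p.preimage_mono hx) $(hg x))
    have h2 := congr(ConeGIT.res (p.preimage_mono hy) $(hg y))
    rw [res_pull, res_res] at h1 h2
    rw [pull_res, pull_res, h1, h2]
  obtain ⟨s, hs⟩ := exists_res_eq hDV hV g fun x y => hglue x y _ _ _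
  refine ⟨s, ?_⟩
  refine eq_of_res_eq (U := fun y => p ⁻¹ᵁ D y) (fun y => p.preimage_mono (hDV y))
    (fun x hx => ?_) fun y => ?_
  · exact TopologicalSpace.Opens.mem_iSup.2 ⟨⟨p x, hx⟩, hyD _⟩
  · rw [← hg y, ← hs y, res_pull, pull_res]

end Descent

/-! ### Good quotients from a cover of the target -/

section GoodQuotient

variable {K : Type u} [Field K] {G : KScheme K} [MonObj G] {X Y : KScheme K} [ModObj G X]

lemma isInvariantFunction_iff {W : X.left.Opens} (f : Γ(X.left, W)) :
    IsInvariantFunction G X f ↔ IsEqualized (act G X).left (snd G X).left f := Iff.rfl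

/-- A criterion for good quotients in terms of a cover of the target. -/
theorem isGoodQuotient_of_cover [QuasiCompact (snd G X).left] {p : X ⟶ Y}
    (hp : act G X ≫ p = snd G X ≫ p) {J : Type*} (V : J → Y.left.Opens) (hV : ⨆ i, V i = ⊤)
    (hVaff : ∀ i, IsAffineOpen (V i)) (hU : ∀ i, IsAffineOpen (p.left ⁻¹ᵁ V i))
    (h : ∀ i, DescendsOver (act G X).left (snd G X).left p.left (V i)) :
    IsGoodQuotient G p := by
  have hp' : (act G X).left ≫ p.left = (snd G X).left ≫ p.left := congr(($hp).left)
  have hall := descendsOver_of_locally (o₁ := (act G X).left) (o₂ := (snd G X).left)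
    (p := p.left) (fun W y hy => by
      obtain ⟨i, hi⟩ := TopologicalSpace.Opens.mem_iSup.1 (hV.ge (Set.mem_univ y))
      obtain ⟨b, hbW, hyb⟩ := (hVaff i).exists_basicOpen_le ⟨y, hy⟩ hi
      refine ⟨_, hyb, hbW, (h i).basicOpen hp' (hVaff i) (hU i) ?_ b⟩
      -- The preimage of `V i` is invariant, so the intersection is a product with the group,
      -- quasi-compact because the projection is.
      have he : (act G X).left ⁻¹ᵁ (p.left ⁻¹ᵁ V i) ⊓ (snd G X).left ⁻¹ᵁ (p.left ⁻¹ᵁ V i) =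
          (snd G X).left ⁻¹ᵁ (p.left ⁻¹ᵁ V i) := by
        rw [← Scheme.Hom.comp_preimage, ← Scheme.Hom.comp_preimage, hp', inf_idem]
      rw [he]
      exact QuasiCompact.isCompact_preimage (f := (snd G X).left) _ (p.left ⁻¹ᵁ V i).2
        (hU i).isCompact)
  have happ (W : Y.left.Opens) :
      (p.left.app W : Γ(Y.left, W) → Γ(X.left, p.left ⁻¹ᵁ W)) = pull p.left W _ le_rfl :=
    funext (app_eq_pull p.left W)
  refine ⟨isAffineHom_of_forall_exists_isAffineOpen _ fun y => ?_, hp, fun W => ?_, fun W f => ?_⟩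
  · obtain ⟨i, hi⟩ := TopologicalSpace.Opens.mem_iSup.1 (hV.ge (Set.mem_univ y))
    exact ⟨V i, hi, hVaff i, hU i⟩
  · rw [happ]
    exact (hall W).1
  · rw [happ, isInvariantFunction_iff]
    refine ⟨?_, fun hf => (hall W).2 f hf⟩
    rintro ⟨g, rfl⟩
    exact isEqualized_pull hp' W g

end GoodQuotient

end ConeGIT

end

noncomputable section

namespace ConeGIT

/-! ### The torus action on the open set -/

section Action

variable (K : Type u) [Field K]

/-- The functions whose loci of invertibility cover `coneOpen`. -/
def den : Fin 2 → coneRing K := ![coord K 1 * coord K 2, coord K 0 * coord K 3]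

variable {K}

lemma mem_coneOpen_iff_exists {W : KScheme K} (f : W ⟶ cone K) (x : W.left) :
    f.left x ∈ coneOpen K ↔ ∃ i, x ∈ W.left.basicOpen (comor K f (den K i)) := by
  rw [Fin.exists_fin_two, ← preimage_basicOpen_comor, ← preimage_basicOpen_comor]
  exact Iff.rfl

lemma isUnit_comor_single {W : KScheme K} (g : W ⟶ torus K) (w : ℤ × ℤ) :
    IsUnit (comor K g (AddMonoidAlgebra.single w 1)) := by
  refine IsUnit.map _ (IsUnit.of_mul_eq_one (AddMonoidAlgebra.single (-w) 1) ?_)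
  rw [AddMonoidAlgebra.single_mul_single, add_neg_cancel, _root_.mul_one]
  rfl

/-- The action multiplies the coordinates by characters, which are units, and so preserves the loci
where the products of coordinates are invertible. -/
lemma smul_mem_coneOpen_iff {W : KScheme K} (g : W ⟶ torus K) (f : W ⟶ cone K) (x : W.left) :
    (g • f : W ⟶ cone K).left x ∈ coneOpen K ↔ f.left x ∈ coneOpen K := by
  have h (i : Fin 2) : W.left.basicOpen (comor K (g • f) (den K i)) =
      W.left.basicOpen (comor K f (den K i)) := by
    have key (k l : Fin 4) : W.left.basicOpen (comor K (g • f) (coord K k * coord K l)) =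
        W.left.basicOpen (comor K f (coord K k * coord K l)) := by
      simp only [map_mul, comor_smul, Scheme.basicOpen_mul,
        Scheme.basicOpen_of_isUnit _ (isUnit_comor_single g _), top_inf_eq]
    fin_cases i
    · exact key 1 2
    · exact key 0 3
  simp_rw [mem_coneOpen_iff_exists, h]

variable (K) in
/-- The open subset of the cone as a scheme. -/
abbrev coneSub : KScheme K := openSub (cone K) (coneOpen K)

variable (K) in
/-- The inclusion of the open subset. -/
abbrev coneIncl : coneSub K ⟶ cone K := openIncl (cone K) (coneOpen K)

lemma range_subset_of_comp {W : KScheme K} (f : W ⟶ cone K) (h : ∀ x, f.left x ∈ coneOpen K) :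
    Set.range f.left ⊆ Set.range (coneIncl K).left := by
  rw [range_openIncl]
  rintro _ ⟨x, rfl⟩
  exact h x

lemma coneIncl_mem (x : (coneSub K).left) : (coneIncl K).left x ∈ coneOpen K := by
  rw [← SetLike.mem_coe, ← range_openIncl]
  exact ⟨x, rfl⟩

variable (K) in
/-- The action morphism on the open subset. -/
def subAct : torus K ⊗ coneSub K ⟶ coneSub K :=
  immersionLift (coneIncl K) (fst _ _ • (snd _ _ ≫ coneIncl K)) (range_subset_of_comp _ fun x => by
    rw [smul_mem_coneOpen_iff]
    exact coneIncl_mem _)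

lemma lift_subAct {W : KScheme K} (g : W ⟶ torus K) (x : W ⟶ coneSub K) :
    (lift g x ≫ subAct K) ≫ coneIncl K = g • (x ≫ coneIncl K) := by
  rw [Category.assoc, subAct, immersionLift_comp, ModObj.comp_smul, lift_fst, lift_snd_assoc]

instance subAction (K : Type u) [Field K] : ModObj (torus K) (coneSub K) where
  smul := subAct K
  one_smul := by
    have h : η[torus K] ▷ coneSub K = lift (1 : _ ⟶ torus K) (snd _ _) := by
      ext1
      · rw [whiskerRight_fst, lift_fst, Hom.one_def]
        congr 1
      · rw [whiskerRight_snd, lift_snd]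
    change η[torus K] ▷ coneSub K ≫ subAct K = (λ_ _).hom
    rw [h, ← cancel_mono (coneIncl K), lift_subAct, one_smul, leftUnitor_hom]
  mul_smul := by
    have h : μ[torus K] ▷ coneSub K =
        lift ((fst _ _ ≫ fst _ _) * (fst _ _ ≫ snd _ _)) (snd _ _) := by
      rw [Hom.mul_def]
      ext1 <;> simp
    have h' : (α_ _ _ _).hom ≫ torus K ◁ subAct K =
        lift (fst _ _ ≫ fst _ _) (lift (fst _ _ ≫ snd _ _) (snd _ _) ≫ subAct K) := by
      ext1
      · simp
      · simp only [Category.assoc, whiskerLeft_snd, lift_snd]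
        rw [← Category.assoc]
        congr 1
        ext1 <;> simp
    change μ[torus K] ▷ coneSub K ≫ subAct K =
      (α_ _ _ _).hom ≫ torus K ◁ subAct K ≫ subAct K
    rw [reassoc_of% h', h, ← cancel_mono (coneIncl K), lift_subAct, lift_subAct, lift_subAct,
      SemigroupAction.mul_smul]

lemma smul_comp_coneIncl {W : KScheme K} (g : W ⟶ torus K) (x : W ⟶ coneSub K) :
    (g • x) ≫ coneIncl K = g • (x ≫ coneIncl K) := lift_subAct g x

instance coneIncl_isModHom (K : Type u) [Field K] : IsModHom (torus K) (coneIncl K) where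
  smul_hom := by
    change subAct K ≫ coneIncl K = torus K ◁ coneIncl K ≫ torusAct K
    rw [subAct, immersionLift_comp]
    change lift _ _ ≫ torusAct K = _
    congr 1

end Action

end ConeGIT

end

noncomputable section

namespace ConeGIT

/-! ### Invariant functions on the two patches -/

section Patches

variable (K : Type u) [Field K]

lemma coord_relation : coord K 0 * coord K 2 = coord K 1 * coord K 3 := by
  rw [coord, coord, coord, coord, ← map_mul, ← map_mul, Ideal.Quotient.eq]
  exact Ideal.subset_span rfl

/-- The ring of functions on a patch of `coneOpen`. -/
abbrev patchRing (i : Fin 2) : Type u := Localization.Away (den K i)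

/-- The coordinate functions on a patch. -/
def pcoord (i : Fin 2) (k : Fin 4) : patchRing K i := algebraMap (coneRing K) _ (coord K k)

/-- The inverse of the denominator. -/
def invDen (i : Fin 2) : patchRing K i := IsLocalization.Away.invSelf (den K i)

/-- The numerator of the invariant function on a patch. -/
def num : Fin 2 → coneRing K := ![coord K 0 * coord K 1 ^ 6, coord K 1 ^ 2 * coord K 3 ^ 9]

/-- The exponent of the denominator of the invariant function on a patch. -/
def denExp : Fin 2 → ℕ := ![4, 5]

/-- The invariant function on a patch. -/
def ratio (i : Fin 2) : patchRing K i := algebraMap _ _ (num K i) * invDen K i ^ denExp i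

variable {K}

lemma pcoord_relation (i : Fin 2) :
    pcoord K i 0 * pcoord K i 2 = pcoord K i 1 * pcoord K i 3 := by
  simp only [pcoord, ← map_mul, coord_relation]

lemma den_mul_invDen (i : Fin 2) : algebraMap _ (patchRing K i) (den K i) * invDen K i = 1 :=
  IsLocalization.Away.mul_invSelf _

lemma ratio_mul (i : Fin 2) :
    ratio K i * algebraMap _ (patchRing K i) (den K i) ^ denExp i = algebraMap _ _ (num K i) := by
  rw [ratio, _root_.mul_assoc, ← mul_pow, mul_comm (invDen K i), den_mul_invDen, one_pow,
    _root_.mul_one]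

/-- Equality of fractions after cross-multiplication. The spare unit `c` provides the factor that
makes the relation z₁z₃ = z₂z₄ applicable to a monomial. -/
lemma eq_pow_ratio {i : Fin 2} {x : patchRing K i} {n k : ℕ} {y : patchRing K i}
    (hx : x = y * invDen K i ^ n) {c : patchRing K i} (hc : IsUnit c)
    (h : c * y * algebraMap _ _ (den K i) ^ (denExp i * k) =
      c * algebraMap _ _ (num K i) ^ k * algebraMap _ _ (den K i) ^ n) :
    x = ratio K i ^ k := by
  have hu : IsUnit (algebraMap _ (patchRing K i) (den K i)) :=
    IsUnit.of_mul_eq_one _ (den_mul_invDen i)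
  have hn : invDen K i ^ n * algebraMap _ (patchRing K i) (den K i) ^ n = 1 := by
    rw [← mul_pow, mul_comm, den_mul_invDen, one_pow]
  apply (hc.mul ((hu.pow n).mul (hu.pow (denExp i * k)))).mul_left_cancel
  rw [hx]
  have h2 : ratio K i ^ k * algebraMap _ _ (den K i) ^ (denExp i * k) =
      algebraMap _ _ (num K i) ^ k := by
    rw [pow_mul, ← mul_pow, ratio_mul]
  linear_combination (c * y * algebraMap _ _ (den K i) ^ (denExp i * k)) * hn + h -
    c * algebraMap _ _ (den K i) ^ n * h2

/-- The homomorphism from the functions on a patch determined by a point of the cone at which the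
denominator is invertible. -/
def patchHom {R : Type u} [CommRing R] [Algebra K R] (i : Fin 2) (φ : coneRing K →ₐ[K] R)
    (h : IsUnit (φ (den K i))) : patchRing K i →ₐ[K] R :=
  IsLocalization.Away.liftAlgHom (den K i) h

lemma patchHom_algebraMap {R : Type u} [CommRing R] [Algebra K R] (i : Fin 2)
    (φ : coneRing K →ₐ[K] R) (h : IsUnit (φ (den K i))) (a : coneRing K) :
    patchHom i φ h (algebraMap _ _ a) = φ a :=
  IsLocalization.Away.lift_eq (den K i) h a

/-! ### The slices -/

/-- A slice of the torus action on a patch. -/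
def slice (i : Fin 2) : patchRing K i →ₐ[K] Polynomial K :=
  patchHom i (coneHom (![![Polynomial.X, 1, 1, Polynomial.X], ![1, Polynomial.X, Polynomial.X, 1]] i)
    (by fin_cases i <;> simp)) (by
      fin_cases i <;> simp [den, coneHom_coord])

/-- The square on the second patch is unavoidable: the torus element (-1, 1) fixes z₁ and z₄ and
maps the slice point (1, d, d, 1) to (1, -d, -d, 1). -/
lemma slice_ratio (i : Fin 2) :
    slice i (ratio K i) = Polynomial.X ^ (i.val + 1) := by
  have h := congr(slice i $(ratio_mul (K := K) i))
  rw [map_mul, map_pow, slice, patchHom_algebraMap, patchHom_algebraMap, ← slice] at h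
  fin_cases i <;> simpa [den, num, coneHom_coord] using h

/-- Restricted to the slice, the map becomes the substitution of a positive power of the variable.
-/
lemma aeval_ratio_injective (i : Fin 2) :
    Function.Injective (Polynomial.aeval (R := K) (ratio K i)) := by
  have h : (slice i).comp (Polynomial.aeval (R := K) (ratio K i)) =
      Polynomial.expand K (i.val + 1) := by
    apply Polynomial.algHom_ext
    simp [slice_ratio]
  have h2 : Function.Injective ((slice i).comp (Polynomial.aeval (R := K) (ratio K i))) := by
    rw [h]
    exact Polynomial.expand_injective (Nat.succ_pos _)
  exact fun p q hpq => h2 (congrArg (slice i) hpq)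

/-! ### The coaction -/

/-- The weight of the denominator. -/
def denWeight : Fin 2 → ℤ × ℤ := ![(2, 3), (4, -1)]

variable (K) in
/-- The group algebra of the character group of the torus. -/
abbrev torusRing : Type u := AddMonoidAlgebra K (ℤ × ℤ)

variable (K) in
/-- The action on the coordinates of a patch. -/
def coneCoaction (i : Fin 2) : coneRing K →ₐ[K] torusRing K ⊗[K] patchRing K i :=
  coneHom (fun k => AddMonoidAlgebra.single (weight k) (1 : K) ⊗ₜ[K] pcoord K i k) (by
    simp [AddMonoidAlgebra.single_mul_single, weight, pcoord_relation])

lemma coneCoaction_den (i : Fin 2) : coneCoaction K i (den K i) =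
    AddMonoidAlgebra.single (denWeight i) (1 : K) ⊗ₜ[K] algebraMap _ (patchRing K i) (den K i) := by
  fin_cases i <;>
  simp [den, denWeight, coneCoaction, coneHom_coord, AddMonoidAlgebra.single_mul_single, weight,
    pcoord]

lemma single_tmul_mul {i : Fin 2} (v w : ℤ × ℤ) (a b : patchRing K i) :
    (AddMonoidAlgebra.single v (1 : K) ⊗ₜ[K] a) * (AddMonoidAlgebra.single w (1 : K) ⊗ₜ[K] b) =
      AddMonoidAlgebra.single (v + w) (1 : K) ⊗ₜ[K] (a * b) := by
  rw [Algebra.TensorProduct.tmul_mul_tmul, AddMonoidAlgebra.single_mul_single, _root_.mul_one]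

lemma single_tmul_pow {i : Fin 2} (v : ℤ × ℤ) (a : patchRing K i) (n : ℕ) :
    (AddMonoidAlgebra.single v (1 : K) ⊗ₜ[K] a) ^ n =
      AddMonoidAlgebra.single (n • v) (1 : K) ⊗ₜ[K] (a ^ n) := by
  rw [Algebra.TensorProduct.tmul_pow, AddMonoidAlgebra.single_pow, one_pow]

lemma coneCoaction_den_mul (i : Fin 2) : coneCoaction K i (den K i) *
    (AddMonoidAlgebra.single (-denWeight i) (1 : K) ⊗ₜ[K] invDen K i) = 1 := by
  rw [coneCoaction_den, single_tmul_mul, add_neg_cancel, den_mul_invDen]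
  rfl

variable (K) in
/-- The comorphism of the torus action on a patch. -/
def patchCoaction (i : Fin 2) : patchRing K i →ₐ[K] torusRing K ⊗[K] patchRing K i :=
  patchHom i (coneCoaction K i) (IsUnit.of_mul_eq_one _ (coneCoaction_den_mul i))

lemma patchCoaction_pcoord (i : Fin 2) (k : Fin 4) : patchCoaction K i (pcoord K i k) =
    AddMonoidAlgebra.single (weight k) (1 : K) ⊗ₜ[K] pcoord K i k := by
  rw [patchCoaction, pcoord, patchHom_algebraMap, coneCoaction, coneHom_coord]
  rfl

lemma patchCoaction_invDen (i : Fin 2) : patchCoaction K i (invDen K i) =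
    AddMonoidAlgebra.single (-denWeight i) (1 : K) ⊗ₜ[K] invDen K i := by
  have h := congr(patchCoaction K i $(den_mul_invDen (K := K) i))
  rw [map_mul, map_one, patchCoaction, patchHom_algebraMap, ← patchCoaction] at h
  exact left_inv_eq_right_inv (a := coneCoaction K i (den K i)) (by rw [mul_comm]; exact h)
    (coneCoaction_den_mul i)

variable (K) in
/-- The coefficient of the trivial character. -/
def coeffZero : torusRing K →ₗ[K] K where
  toFun f := f.coeff 0
  map_add' _ _ := rfl
  map_smul' _ _ := rfl

variable (K) in
/-- The projection of the functions on a patch to the invariant functions. -/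
def reynolds (i : Fin 2) : patchRing K i →ₗ[K] patchRing K i :=
  (TensorProduct.lid K (patchRing K i)).toLinearMap ∘ₗ
    (coeffZero K).rTensor (patchRing K i) ∘ₗ (patchCoaction K i).toLinearMap

lemma reynolds_of_coaction {i : Fin 2} {f : patchRing K i} {w : ℤ × ℤ}
    (h : patchCoaction K i f = AddMonoidAlgebra.single w (1 : K) ⊗ₜ[K] f) :
    reynolds K i f = if w = 0 then f else 0 := by
  change TensorProduct.lid K _ ((coeffZero K).rTensor _ (patchCoaction K i f)) = _
  rw [h, LinearMap.rTensor_tmul, TensorProduct.lid_tmul]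
  have : coeffZero K (AddMonoidAlgebra.single w 1) = if w = 0 then 1 else 0 := by
    change (AddMonoidAlgebra.single w (1 : K)).coeff 0 = _
    rw [AddMonoidAlgebra.coeff_single, Finsupp.single_apply]
  rw [this]
  split_ifs <;> simp

/-- A monomial on a patch. -/
def pmonomial (i : Fin 2) (s : Fin 4 → ℕ) (n : ℕ) : patchRing K i :=
  (pcoord K i 0 ^ s 0 * pcoord K i 1 ^ s 1 * pcoord K i 2 ^ s 2 * pcoord K i 3 ^ s 3) *
    invDen K i ^ n

lemma patchCoaction_pmonomial (i : Fin 2) (s : Fin 4 → ℕ) (n : ℕ) :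
    patchCoaction K i (pmonomial (K := K) i s n) = AddMonoidAlgebra.single
      (s 0 • weight 0 + s 1 • weight 1 + s 2 • weight 2 + s 3 • weight 3 + n • (-denWeight i))
        (1 : K) ⊗ₜ[K] pmonomial i s n := by
  rw [pmonomial]
  simp only [map_mul, map_pow, patchCoaction_pcoord, patchCoaction_invDen, single_tmul_pow,
    single_tmul_mul]

lemma isUnit_pcoord {i : Fin 2} {k l : Fin 4} (h : den K i = coord K k * coord K l) :
    IsUnit (pcoord K i k) ∧ IsUnit (pcoord K i l) := by
  have hu : IsUnit (algebraMap _ (patchRing K i) (den K i)) :=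
    IsUnit.of_mul_eq_one _ (den_mul_invDen i)
  have e : algebraMap _ (patchRing K i) (den K i) = pcoord K i k * pcoord K i l :=
    (congrArg (algebraMap _ (patchRing K i)) h).trans (map_mul _ _ _)
  generalize algebraMap _ (patchRing K i) (den K i) = d at hu e
  rw [e] at hu
  exact IsUnit.mul_iff.1 hu

/-- Here z₄ = z₁z₃/z₂ can be eliminated, and a Laurent monomial of weight zero in z₁, z₂, z₃ is
determined by its exponent at z₁. -/
lemma pmonomial_zero_eq_ratio_pow (s : Fin 4 → ℕ) (n : ℕ)
    (h : s 0 • weight 0 + s 1 • weight 1 + s 2 • weight 2 + s 3 • weight 3 +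
      n • (-denWeight 0) = 0) : ∃ k : ℕ, pmonomial (K := K) 0 s n = ratio K 0 ^ k := by
  have h1 := congrArg Prod.fst h
  have h2 := congrArg Prod.snd h
  have hrel := pcoord_relation (K := K) 0
  simp [weight, denWeight] at h1 h2
  have hu := (isUnit_pcoord (K := K) (i := 0) (k := 1) (l := 2) rfl).1
  -- The exponent of z₁ after elimination of z₄; it is 1 in the generator. The unit z₂ to the power
  -- `s 3` allows the elimination.
  refine ⟨s 0 + s 3, eq_pow_ratio rfl (hu.pow (s 3)) ?_⟩
  have hs1 : s 1 = n + s 3 + 2 * (s 0 + s 3) := by omega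
  have hs2 : n = s 2 + s 3 + 4 * (s 0 + s 3) := by omega
  have h3 : pcoord K 0 1 ^ s 3 * pcoord K 0 3 ^ s 3 = pcoord K 0 0 ^ s 3 * pcoord K 0 2 ^ s 3 := by
    rw [← mul_pow, ← mul_pow, ← hrel]
  have hden : algebraMap _ (patchRing K 0) (den K 0) = pcoord K 0 1 * pcoord K 0 2 := map_mul _ _ _
  have hnum : algebraMap _ (patchRing K 0) (num K 0) = pcoord K 0 0 * pcoord K 0 1 ^ 6 := by
    simp [num, pcoord]
  change _ * _ * algebraMap _ (patchRing K 0) (den K 0) ^ (4 * _) =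
    _ * algebraMap _ (patchRing K 0) (num K 0) ^ _ * algebraMap _ (patchRing K 0) (den K 0) ^ _
  rw [hden, hnum]
  change pcoord K 0 1 ^ s 3 * (pcoord K 0 0 ^ s 0 * pcoord K 0 1 ^ s 1 * pcoord K 0 2 ^ s 2 *
    pcoord K 0 3 ^ s 3) * _ = _
  rw [show pcoord K 0 1 ^ s 3 * (pcoord K 0 0 ^ s 0 * pcoord K 0 1 ^ s 1 * pcoord K 0 2 ^ s 2 *
    pcoord K 0 3 ^ s 3) = (pcoord K 0 1 ^ s 3 * pcoord K 0 3 ^ s 3) *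
      (pcoord K 0 0 ^ s 0 * pcoord K 0 1 ^ s 1 * pcoord K 0 2 ^ s 2) by ring, h3, hs1, hs2]
  ring

/-- Here z₃ = z₂z₄/z₁ can be eliminated, and a Laurent monomial of weight zero in z₁, z₂, z₄ is
determined by its exponent at z₂. -/
lemma pmonomial_one_eq_ratio_pow (s : Fin 4 → ℕ) (n : ℕ)
    (h : s 0 • weight 0 + s 1 • weight 1 + s 2 • weight 2 + s 3 • weight 3 +
      n • (-denWeight 1) = 0) : ∃ k : ℕ, pmonomial (K := K) 1 s n = ratio K 1 ^ k := by
  have h1 := congrArg Prod.fst h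
  have h2 := congrArg Prod.snd h
  have hrel := pcoord_relation (K := K) 1
  simp [weight, denWeight] at h1 h2
  have hu := (isUnit_pcoord (K := K) (i := 1) (k := 0) (l := 3) rfl).1
  -- The exponent of z₂ is even because the t₁-weights of z₂ and z₃ are odd, while those of z₁, z₄
  -- and the denominator are even; it is 2 in the generator.
  obtain ⟨k, hk⟩ : ∃ k, s 1 + s 2 = 2 * k := ⟨(s 1 + s 2) / 2, by omega⟩
  refine ⟨k, eq_pow_ratio rfl (hu.pow (s 2)) ?_⟩
  have hs0 : s 0 + 5 * k = s 2 + n := by omega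
  have hs3 : s 2 + s 3 = 4 * k + n := by omega
  have h3 : pcoord K 1 0 ^ s 2 * pcoord K 1 2 ^ s 2 = pcoord K 1 1 ^ s 2 * pcoord K 1 3 ^ s 2 := by
    rw [← mul_pow, ← mul_pow]
    exact congr($hrel ^ s 2)
  have hden : algebraMap _ (patchRing K 1) (den K 1) = pcoord K 1 0 * pcoord K 1 3 := map_mul _ _ _
  have hnum : algebraMap _ (patchRing K 1) (num K 1) = pcoord K 1 1 ^ 2 * pcoord K 1 3 ^ 9 := by
    simp [num, pcoord]
  change _ * _ * algebraMap _ (patchRing K 1) (den K 1) ^ (5 * _) =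
    _ * algebraMap _ (patchRing K 1) (num K 1) ^ _ * algebraMap _ (patchRing K 1) (den K 1) ^ _
  rw [hden, hnum]
  change pcoord K 1 0 ^ s 2 * (pcoord K 1 0 ^ s 0 * pcoord K 1 1 ^ s 1 * pcoord K 1 2 ^ s 2 *
    pcoord K 1 3 ^ s 3) * _ = _
  calc pcoord K 1 0 ^ s 2 * (pcoord K 1 0 ^ s 0 * pcoord K 1 1 ^ s 1 * pcoord K 1 2 ^ s 2 *
        pcoord K 1 3 ^ s 3) * (pcoord K 1 0 * pcoord K 1 3) ^ (5 * k)
      = (pcoord K 1 0 ^ s 2 * pcoord K 1 2 ^ s 2) * (pcoord K 1 1 ^ s 1 *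
        pcoord K 1 0 ^ (s 0 + 5 * k) * pcoord K 1 3 ^ (s 3 + 5 * k)) := by ring
    _ = pcoord K 1 1 ^ (s 1 + s 2) * pcoord K 1 0 ^ (s 0 + 5 * k) *
        pcoord K 1 3 ^ (s 2 + s 3 + 5 * k) := by rw [h3]; ring
    _ = _ := by rw [hs0, hs3, hk]; ring

lemma pmonomial_eq_ratio_pow (i : Fin 2) (s : Fin 4 → ℕ) (n : ℕ)
    (h : s 0 • weight 0 + s 1 • weight 1 + s 2 • weight 2 + s 3 • weight 3 +
      n • (-denWeight i) = 0) : ∃ k : ℕ, pmonomial (K := K) i s n = ratio K i ^ k :=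
  match i with
  | 0 => pmonomial_zero_eq_ratio_pow s n h
  | 1 => pmonomial_one_eq_ratio_pow s n h

/-- By linearity it suffices to treat monomials over a power of the denominator. These are weight
vectors: those of nonzero weight are killed, those of weight zero are powers of the generator. -/
lemma reynolds_mem_range (i : Fin 2) (f : patchRing K i) :
    reynolds K i f ∈ (Polynomial.aeval (R := K) (ratio K i)).range := by
  obtain ⟨n, a, ha⟩ := IsLocalization.Away.surj (den K i) f
  have hf : f = algebraMap _ _ a * invDen K i ^ n := by
    rw [← ha, _root_.mul_assoc, ← mul_pow, den_mul_invDen, one_pow, _root_.mul_one]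
  obtain ⟨q, rfl⟩ := Ideal.Quotient.mk_surjective a
  rw [hf]
  clear hf ha f
  induction q using MvPolynomial.induction_on' with
  | monomial s c =>
    have h1 : algebraMap (coneRing K) (patchRing K i) (Ideal.Quotient.mk _
        (MvPolynomial.monomial s c)) * invDen K i ^ n = c • pmonomial i s n := by
      have h2 : Ideal.Quotient.mk (coneIdeal K) (MvPolynomial.monomial s c) =
          algebraMap K (coneRing K) c *
            (coord K 0 ^ s 0 * coord K 1 ^ s 1 * coord K 2 ^ s 2 * coord K 3 ^ s 3) := by
        rw [MvPolynomial.monomial_eq, Finsupp.prod_fintype _ _ (fun _ => pow_zero _),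
          Fin.prod_univ_four, map_mul]
        simp only [map_mul, map_pow]
        rfl
      rw [h2, pmonomial, Algebra.smul_def, IsScalarTower.algebraMap_apply K (coneRing K) (patchRing K i)]
      simp only [map_mul, map_pow, pcoord]
      ring
    rw [h1, map_smul, reynolds_of_coaction (patchCoaction_pmonomial i s n)]
    refine Subalgebra.smul_mem _ ?_ c
    split_ifs with hw
    · obtain ⟨k, hk⟩ := pmonomial_eq_ratio_pow (K := K) i s n hw
      exact ⟨Polynomial.X ^ k, by simp [hk]⟩
    · exact zero_mem _
  | add p q hp hq =>
    rw [map_add, map_add, add_mul, map_add]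
    exact add_mem hp hq

lemma mem_range_of_invariant {i : Fin 2} {f : patchRing K i}
    (h : patchCoaction K i f = 1 ⊗ₜ[K] f) : ∃ q, Polynomial.aeval (R := K) (ratio K i) q = f := by
  -- The unit of the group algebra is `single 0 1`, so invariance is the case of weight zero.
  have h1 := reynolds_of_coaction (w := 0) (f := f) h
  rw [if_pos rfl] at h1
  have h2 := reynolds_mem_range i f
  rw [h1] at h2
  exact h2

end Patches

end ConeGIT

end

noncomputable section

namespace ConeGIT

/-! ### Gluing morphisms over an open cover -/

section Gluing

variable {K : Type u} [Field K] {J : Type} {U : J → KScheme K} {X : KScheme K} (j : ∀ i, U i ⟶ X)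
  [∀ i, IsOpenImmersion (j i).left]

instance mono_of_isOpenImmersion {X Y : KScheme K} (f : X ⟶ Y) [IsOpenImmersion f.left] : Mono f :=
  (Over.forget _).mono_of_mono_map (inferInstanceAs (Mono f.left))

/-- Compatible morphisms on the members of an open cover can be glued. -/
lemma exists_glue (hj : ∀ x, ∃ i y, (j i).left y = x) {Y : KScheme K} (f : ∀ i, U i ⟶ Y)
    (hf : ∀ i i' (W : KScheme K) (a : W ⟶ U i) (b : W ⟶ U i'), a ≫ j i = b ≫ j i' →
      a ≫ f i = b ≫ f i') : ∃ g : X ⟶ Y, ∀ i, j i ≫ g = f i := by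
  let C : X.left.OpenCover := Scheme.Cover.mkOfCovers J (fun i => (U i).left) (fun i => (j i).left) hj
  have hC (i i' : J) : Limits.pullback.fst (j i).left (j i').left ≫ (f i).left =
      Limits.pullback.snd (j i).left (j i').left ≫ (f i').left := by
    let P : KScheme K := Over.mk (Limits.pullback.fst (j i).left (j i').left ≫ (U i).hom)
    let a : P ⟶ U i := Over.homMk (Limits.pullback.fst _ _) rfl
    let b : P ⟶ U i' := Over.homMk (Limits.pullback.snd _ _) (by
      change _ = Limits.pullback.fst _ _ ≫ (U i).hom
      rw [← Over.w (j i), ← Over.w (j i'), Limits.pullback.condition_assoc])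
    have hab : a ≫ j i = b ≫ j i' := by
      ext1
      exact Limits.pullback.condition
    exact congr(($(hf i i' P a b hab)).left)
  let g : X.left ⟶ Y.left := C.glueMorphisms (fun i => (f i).left) hC
  have hg (i : J) : (j i).left ≫ g = (f i).left := C.ι_glueMorphisms _ _ i
  have hw (i : J) : (j i).left ≫ g ≫ Y.hom = (j i).left ≫ X.hom := by
    rw [reassoc_of% hg, Over.w, Over.w]
  refine ⟨Over.homMk g (C.hom_ext _ _ hw), fun i => ?_⟩
  ext1
  exact hg i

/-- Morphisms that agree over the members of an open cover are equal. -/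
lemma hom_ext_of_cover (hj : ∀ x, ∃ i y, (j i).left y = x) {Y Z : KScheme K} (s : Z ⟶ X)
    {p q : Z ⟶ Y} (h : ∀ i (W : KScheme K) (k : W ⟶ Z) (a : W ⟶ U i), k ≫ s = a ≫ j i →
      k ≫ p = k ≫ q) : p = q := by
  ext1
  refine Scheme.hom_ext_of_forall _ _ fun z => ?_
  obtain ⟨i, y, hy⟩ := hj (s.left z)
  let V : Z.left.Opens := s.left ⁻¹ᵁ (j i).left.opensRange
  have hV : Set.range (openIncl Z V ≫ s).left ⊆ Set.range (j i).left := by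
    rintro _ ⟨x, rfl⟩
    have hx : (openIncl Z V).left x ∈ (V : Set Z.left) := by
      rw [← range_openIncl]
      exact ⟨x, rfl⟩
    exact hx
  refine ⟨V, ⟨y, hy⟩, ?_⟩
  exact congr(($(h i _ (openIncl Z V) (immersionLift (j i) _ hV)
    (immersionLift_comp (j i) _ hV).symm)).left)

end Gluing

/-! ### Functions on images of open immersions -/

section Sections

/-- Functions on the image of an open immersion. -/
lemma pull_bijective {X Y : Scheme.{u}} (f : X ⟶ Y) [IsOpenImmersion f] {V : Y.Opens}
    (hV : Set.range f = (V : Set Y)) (e : ⊤ ≤ f ⁻¹ᵁ V) : Function.Bijective (pull f V ⊤ e) := by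
  have h1 : IsIso (f.app V) := f.isIso_app V (by
    intro x hx
    rw [← SetLike.mem_coe, ← hV] at hx
    exact hx)
  have h2 : f ⁻¹ᵁ V = ⊤ := top_le_iff.1 e
  have h3 : IsIso (f.appLE V ⊤ e) := by
    rw [Scheme.Hom.appLE]
    have : IsIso (homOfLE e).op := by
      have : IsIso (homOfLE e) := ⟨homOfLE le_top, rfl, rfl⟩
      infer_instance
    infer_instance
  exact ConcreteCategory.bijective_of_isIso (f.appLE V ⊤ e)

lemma top_le_preimage_top {X Y : Scheme.{u}} (f : X ⟶ Y) : ⊤ ≤ f ⁻¹ᵁ ⊤ := fun _ _ => trivial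

variable (K : Type u) [Field K]

lemma pull_left_toΓ {A : Type u} [CommRing A] [Algebra K A] {W : KScheme K}
    (f : W ⟶ affineScheme K A) (a : A) :
    pull f.left ⊤ ⊤ (top_le_preimage_top _) (toΓ K A a) = comor K f a := by
  rw [comor_eq]
  exact (app_eq_pull f.left ⊤ _).symm

instance prodToSpec_isIso (A B : Type u) [CommRing A] [CommRing B] [Algebra K A] [Algebra K B] :
    IsIso (prodToSpec K A B).left :=
  inferInstanceAs (IsIso (pullbackSpecIso K A B).hom)

lemma comor_injective_of_isIso {A : Type u} [CommRing A] [Algebra K A] {W : KScheme K}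
    (f : W ⟶ affineScheme K A) [hf : IsIso f.left] : Function.Injective (comor K f) := by
  have key (g : W.left ⟶ Spec (.of A)) (_ : IsIso g) : Function.Bijective
      ((Scheme.ΓSpecIso (.of A)).inv ≫ g.appTop).hom := by
    have : IsIso g.appTop := inferInstanceAs (IsIso (g.app ⊤))
    exact ConcreteCategory.bijective_of_isIso ((Scheme.ΓSpecIso (.of A)).inv ≫ g.appTop)
  exact (key f.left hf).1

instance quasiCompact_snd {A : Type u} [CommRing A] [Algebra K A] (X : KScheme K) :
    QuasiCompact (snd (affineScheme K A) X).left := by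
  have key (f : Spec (.of A) ⟶ Spec (.of K)) : QuasiCompact (Limits.pullback.snd f X.hom) :=
    inferInstance
  exact key _

end Sections

end ConeGIT

end

noncomputable section

namespace ConeGIT

/-! ### The patches as open subschemes -/

section PatchImmersions

variable (K : Type u) [Field K]

/-- A patch of `coneOpen` as a scheme. -/
abbrev patch (i : Fin 2) : KScheme K := affineScheme K (patchRing K i)

/-- The immersion of a patch into the cone. -/
def patchMap (i : Fin 2) : patch K i ⟶ cone K :=
  affineMap K (IsScalarTower.toAlgHom K (coneRing K) (patchRing K i))

instance patchMap_isOpenImmersion (i : Fin 2) : IsOpenImmersion (patchMap K i).left := by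
  have key : IsOpenImmersion (Spec.map (CommRingCat.ofHom
      (algebraMap (coneRing K) (Localization.Away (den K i))))) := inferInstance
  exact key

variable {K}

lemma comor_patchMap {i : Fin 2} {W : KScheme K} (f : W ⟶ patch K i) (a : coneRing K) :
    comor K (f ≫ patchMap K i) a = comor K f (algebraMap _ _ a) :=
  comor_comp_map K f _ a

lemma comor_patchMap_coord {i : Fin 2} {W : KScheme K} (f : W ⟶ patch K i) (k : Fin 4) :
    comor K (f ≫ patchMap K i) (coord K k) = comor K f (pcoord K i k) :=
  comor_patchMap f _

lemma isUnit_comor_den {i : Fin 2} {W : KScheme K} (f : W ⟶ patch K i) :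
    IsUnit (comor K (f ≫ patchMap K i) (den K i)) := by
  rw [comor_patchMap]
  exact (IsUnit.of_mul_eq_one _ (den_mul_invDen i)).map _

lemma comor_ratio_mul {i : Fin 2} {W : KScheme K} (f : W ⟶ patch K i) :
    comor K f (ratio K i) * comor K (f ≫ patchMap K i) (den K i) ^ denExp i =
      comor K (f ≫ patchMap K i) (num K i) := by
  rw [comor_patchMap, comor_patchMap, ← map_pow, ← map_mul, ratio_mul]

lemma range_patchMap (i : Fin 2) : Set.range (patchMap K i).left =
    (PrimeSpectrum.basicOpen (den K i) : Set (PrimeSpectrum (coneRing K))) :=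
  PrimeSpectrum.localization_away_comap_range (Localization.Away (den K i)) (den K i)

lemma patchMap_mem_coneOpen {i : Fin 2} (x : (patch K i).left) :
    (patchMap K i).left x ∈ coneOpen K := by
  rw [mem_coneOpen_iff_exists]
  refine ⟨i, ?_⟩
  have h := isUnit_comor_den (𝟙 (patch K i))
  rw [Category.id_comp] at h
  rw [Scheme.basicOpen_of_isUnit _ h]
  trivial

variable (K) in
/-- The immersion of a patch into `coneOpen`. -/
def patchIncl (i : Fin 2) : patch K i ⟶ coneSub K :=
  immersionLift (coneIncl K) (patchMap K i) (range_subset_of_comp _ patchMap_mem_coneOpen)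

lemma patchIncl_comp (i : Fin 2) : patchIncl K i ≫ coneIncl K = patchMap K i :=
  immersionLift_comp _ _ _

instance patchIncl_isOpenImmersion (i : Fin 2) : IsOpenImmersion (patchIncl K i).left := by
  have h : IsOpenImmersion ((patchIncl K i).left ≫ (coneIncl K).left) := by
    rw [← Over.comp_left, patchIncl_comp]
    infer_instance
  exact IsOpenImmersion.of_comp _ (coneIncl K).left

lemma coneIncl_injective : Function.Injective (coneIncl K).left :=
  (coneIncl K).left.isOpenEmbedding.injective

lemma mem_range_patchIncl_iff (i : Fin 2) (x : (coneSub K).left) :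
    x ∈ Set.range (patchIncl K i).left ↔ (coneIncl K).left x ∈
      (PrimeSpectrum.basicOpen (den K i) : Set (PrimeSpectrum (coneRing K))) := by
  rw [← range_patchMap]
  have h (y : (patch K i).left) :
      (coneIncl K).left ((patchIncl K i).left y) = (patchMap K i).left y := by
    rw [← patchIncl_comp]
    rfl
  constructor
  · rintro ⟨y, rfl⟩
    exact ⟨y, (h y).symm⟩
  · rintro ⟨y, hy⟩
    exact ⟨y, coneIncl_injective ((h y).trans hy)⟩

lemma exists_patchIncl_eq (x : (coneSub K).left) :
    ∃ (i : Fin 2) (y : (patch K i).left), (patchIncl K i).left y = x := by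
  rcases coneIncl_mem x with h | h
  · exact ⟨0, (mem_range_patchIncl_iff 0 x).2 h⟩
  · exact ⟨1, (mem_range_patchIncl_iff 1 x).2 h⟩

end PatchImmersions

/-! ### The quotient map to the projective line -/

section QuotientMap

variable (K : Type u) [Field K]

lemma ne_add_one (i : Fin 2) : i ≠ i + 1 := by
  fin_cases i <;> decide

/-- The quotient map on a patch. -/
def patchQuot (i : Fin 2) : patch K i ⟶ affineScheme K (Polynomial K) :=
  affineMap K (Polynomial.aeval (ratio K i))

variable {K}

lemma comor_patchQuot {i : Fin 2} {W : KScheme K} (f : W ⟶ patch K i) :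
    comor K (f ≫ patchQuot K i) Polynomial.X = comor K f (ratio K i) := by
  rw [patchQuot, comor_comp_map, Polynomial.aeval_X]

lemma comor_relation {W : KScheme K} (f : W ⟶ cone K) :
    comor K f (coord K 0) * comor K f (coord K 2) =
      comor K f (coord K 1) * comor K f (coord K 3) := by
  rw [← map_mul, ← map_mul, coord_relation]

/-- The product of the two generators is z₂⁴z₄⁴/(z₁⁴z₃⁴), which is 1 by the fourth power of the
relation. -/
lemma comor_ratio_mul_comor_ratio {W : KScheme K} (a : W ⟶ patch K 0) (b : W ⟶ patch K 1)
    (h : a ≫ patchMap K 0 = b ≫ patchMap K 1) :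
    comor K a (ratio K 0) * comor K b (ratio K 1) = 1 := by
  have ha := comor_ratio_mul a
  have hb := comor_ratio_mul b
  have ua := (isUnit_comor_den a).pow 4
  have ub := (isUnit_comor_den b).pow 5
  have hr := comor_relation (a ≫ patchMap K 0)
  rw [← h] at hb ub
  generalize a ≫ patchMap K 0 = f at *
  have hd0 : comor K f (den K 0) = comor K f (coord K 1) * comor K f (coord K 2) := map_mul _ _ _
  have hd1 : comor K f (den K 1) = comor K f (coord K 0) * comor K f (coord K 3) := map_mul _ _ _
  have hn0 : comor K f (num K 0) = comor K f (coord K 0) * comor K f (coord K 1) ^ 6 := by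
    simp [num]
  have hn1 : comor K f (num K 1) = comor K f (coord K 1) ^ 2 * comor K f (coord K 3) ^ 9 := by
    simp [num]
  change _ * _ ^ 4 = _ at ha
  change _ * _ ^ 5 = _ at hb
  apply (ua.mul ub).mul_left_cancel
  rw [hd0, hn0] at ha
  rw [hd1, hn1] at hb
  rw [hd0, hd1]
  generalize comor K f (coord K 0) = z at *
  generalize comor K f (coord K 1) = y at *
  generalize comor K f (coord K 2) = x at *
  generalize comor K f (coord K 3) = w at *
  have h4 : z ^ 4 * x ^ 4 = y ^ 4 * w ^ 4 := by rw [← mul_pow, hr, mul_pow]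
  calc _ = (comor K a (ratio K 0) * (y * x) ^ 4) * (comor K b (ratio K 1) * (z * w) ^ 5) := by ring
    _ = y ^ 4 * z * w ^ 5 * (y ^ 4 * w ^ 4) := by rw [ha, hb]; ring
    _ = _ := by rw [← h4]; ring

lemma chart_congr {i j i' j' : Fin 2} (hi : i = i') (hj : j = j') (h : i ≠ j) (h' : i' ≠ j') :
    chart K h = chart K h' := by
  subst hi hj
  rfl

lemma patchQuot_comp_chart_eq {W : KScheme K} (a : W ⟶ patch K 0) (b : W ⟶ patch K 1)
    (h : a ≫ patchIncl K 0 = b ≫ patchIncl K 1) :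
    a ≫ patchQuot K 0 ≫ chart K (ne_add_one 0) = b ≫ patchQuot K 1 ≫ chart K (ne_add_one 1) := by
  rw [← Category.assoc, ← Category.assoc,
    chart_congr (i' := 0 + 1) (j' := 0) rfl rfl (ne_add_one 1) (ne_add_one 0).symm]
  refine comp_chart_eq K (ne_add_one 0) _ _ ?_
  rw [comor_patchQuot, comor_patchQuot]
  refine comor_ratio_mul_comor_ratio a b ?_
  rw [← patchIncl_comp, ← patchIncl_comp, reassoc_of% h]

variable (K) in
lemma exists_quotient : ∃ p : coneSub K ⟶ projectiveLine K, ∀ i,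
    patchIncl K i ≫ p = patchQuot K i ≫ chart K (ne_add_one i) := by
  refine exists_glue (patchIncl K) exists_patchIncl_eq _ ?_
  rw [Fin.forall_fin_two]
  constructor <;> rw [Fin.forall_fin_two] <;> refine ⟨fun W a b h => ?_, fun W a b h => ?_⟩
  · rw [(cancel_mono _).1 h]
  · exact patchQuot_comp_chart_eq a b h
  · exact (patchQuot_comp_chart_eq b a h.symm).symm
  · rw [(cancel_mono _).1 h]

variable (K) in
/-- The quotient map. -/
def quotientMap : coneSub K ⟶ projectiveLine K := (exists_quotient K).choose

lemma patchIncl_quotientMap (i : Fin 2) : patchIncl K i ≫ quotientMap K =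
    patchQuot K i ≫ chart K (ne_add_one i) := (exists_quotient K).choose_spec i

/-! ### Preimages of the charts -/

/-- Where the generator on one patch is invertible, so is the denominator of the other patch. The
square is used on the first patch because one factor z₁ must remain while another is traded, with
z₃, for z₂z₄. -/
lemma exists_ratio_pow_mul_eq (i : Fin 2) : ∃ (u v : patchRing K i) (n : ℕ), IsUnit u ∧
    ratio K i ^ n * u = algebraMap _ _ (den K (i + 1)) * v := by
  have hr := ratio_mul (K := K) i
  have hrel := pcoord_relation (K := K) i
  have hd0 : algebraMap _ (patchRing K i) (den K 0) = pcoord K i 1 * pcoord K i 2 := map_mul _ _ _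
  have hd1 : algebraMap _ (patchRing K i) (den K 1) = pcoord K i 0 * pcoord K i 3 := map_mul _ _ _
  have hn0 : algebraMap _ (patchRing K i) (num K 0) = pcoord K i 0 * pcoord K i 1 ^ 6 := by
    simp [num, pcoord]
  have hn1 : algebraMap _ (patchRing K i) (num K 1) = pcoord K i 1 ^ 2 * pcoord K i 3 ^ 9 := by
    simp [num, pcoord]
  match i with
  | 0 =>
    change _ * _ ^ 4 = _ at hr
    rw [hd0, hn0] at hr
    have hu := isUnit_pcoord (K := K) (i := 0) (k := 1) (l := 2) rfl
    refine ⟨(pcoord K 0 1 * pcoord K 0 2) ^ 8 * pcoord K 0 2, pcoord K 0 1 ^ 13, 2,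
      ((hu.1.mul hu.2).pow 8).mul hu.2, ?_⟩
    change _ = algebraMap _ (patchRing K 0) (den K 1) * _
    rw [hd1]
    generalize pcoord K 0 0 = z at *
    generalize pcoord K 0 1 = y at *
    generalize pcoord K 0 2 = x at *
    generalize pcoord K 0 3 = w at *
    calc _ = (ratio K 0 * (y * x) ^ 4) ^ 2 * x := by ring
      _ = z * y ^ 12 * (z * x) := by rw [hr]; ring
      _ = _ := by rw [hrel]; ring
  | 1 =>
    change _ * _ ^ 5 = _ at hr
    rw [hd1, hn1] at hr
    have hu := isUnit_pcoord (K := K) (i := 1) (k := 0) (l := 3) rfl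
    refine ⟨(pcoord K 1 0 * pcoord K 1 3) ^ 5, pcoord K 1 0 * pcoord K 1 3 ^ 8, 1,
      (hu.1.mul hu.2).pow 5, ?_⟩
    change _ = algebraMap _ (patchRing K 1) (den K 0) * _
    rw [hd0]
    generalize pcoord K 1 0 = z at *
    generalize pcoord K 1 1 = y at *
    generalize pcoord K 1 2 = x at *
    generalize pcoord K 1 3 = w at *
    calc _ = ratio K 1 * (z * w) ^ 5 := by ring
      _ = y * w ^ 8 * (y * w) := by rw [hr]; ring
      _ = _ := by rw [← hrel]; ring

/-- A point of the other patch that is mapped into the chart has an invertible coordinate there,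
hence lies in both patches. This is what makes the quotient map affine. -/
lemma quotientMap_mem_chartOpen_iff (i : Fin 2) (x : (coneSub K).left) :
    (quotientMap K).left x ∈ chartOpen K i ↔ x ∈ Set.range (patchIncl K i).left := by
  have hp (i : Fin 2) (y : (patch K i).left) : (quotientMap K).left ((patchIncl K i).left y) =
      (chart K (ne_add_one i)).left ((patchQuot K i).left y) :=
    congr(($(patchIncl_quotientMap (K := K) i)).left y)
  constructor
  · intro h
    obtain ⟨i', y, rfl⟩ := exists_patchIncl_eq x
    by_cases hi : i' = i
    · subst hi
      exact ⟨y, rfl⟩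
    obtain rfl : i = i' + 1 := by
      revert hi; clear h hp; fin_cases i <;> fin_cases i' <;> decide
    rw [hp] at h
    have h1 : y ∈ (patchQuot K i').left ⁻¹ᵁ (PrimeSpectrum.basicOpen Polynomial.X :
        TopologicalSpace.Opens (PrimeSpectrum (Polynomial K))) :=
      (chart_mem_chartOpen_iff K (ne_add_one i') _).1 h
    rw [preimage_basicOpen_comor, ← Category.id_comp (patchQuot K i'), comor_patchQuot] at h1
    have h2 : y ∈ (patchMap K i').left ⁻¹ᵁ (PrimeSpectrum.basicOpen (den K (i' + 1)) :
        TopologicalSpace.Opens (PrimeSpectrum (coneRing K))) := by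
      rw [preimage_basicOpen_comor, ← Category.id_comp (patchMap K i'), comor_patchMap]
      obtain ⟨u, v, n, hu, huv⟩ := exists_ratio_pow_mul_eq (K := K) i'
      have h3 := congr((patch K i').left.basicOpen (comor K (𝟙 (patch K i')) $huv))
      rw [map_mul, map_mul, map_pow, Scheme.basicOpen_mul, Scheme.basicOpen_mul,
        Scheme.basicOpen_of_isUnit _ (hu.map _), inf_top_eq] at h3
      have h4 : y ∈ (patch K i').left.basicOpen (comor K (𝟙 (patch K i')) (ratio K i') ^ n) := by
        obtain rfl | hn := n.eq_zero_or_pos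
        · rw [pow_zero, Scheme.basicOpen_of_isUnit _ isUnit_one]
          trivial
        · rw [Scheme.basicOpen_pow _ _ hn]
          exact h1
      rw [h3] at h4
      exact h4.1
    rw [mem_range_patchIncl_iff]
    rw [← patchIncl_comp] at h2
    exact h2
  · rintro ⟨y, rfl⟩
    rw [hp, ← SetLike.mem_coe, ← range_chart K (ne_add_one i)]
    exact ⟨_, rfl⟩

lemma preimage_chartOpen (i : Fin 2) :
    (quotientMap K).left ⁻¹ᵁ chartOpen K i = (patchIncl K i).left.opensRange :=
  TopologicalSpace.Opens.ext (Set.ext fun x => quotientMap_mem_chartOpen_iff i x)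

lemma isAffineOpen_preimage_chartOpen (i : Fin 2) :
    IsAffineOpen ((quotientMap K).left ⁻¹ᵁ chartOpen K i) := by
  rw [preimage_chartOpen]
  have : IsAffine (patch K i).left := inferInstanceAs (IsAffine (Spec (.of (patchRing K i))))
  exact isAffineOpen_opensRange _

/-! ### Invariance -/

variable (K) in
/-- The torus action on a patch. -/
def patchAct (i : Fin 2) : torus K ⊗ patch K i ⟶ patch K i :=
  prodToSpec K _ _ ≫ affineMap K (patchCoaction K i)

/-- The abstract action, restricted to a patch, is given by the explicit coaction; this turns
invariance into algebra. -/
lemma whiskerLeft_patchIncl_act (i : Fin 2) :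
    torus K ◁ patchIncl K i ≫ act (torus K) (coneSub K) = patchAct K i ≫ patchIncl K i := by
  rw [← cancel_mono (coneIncl K)]
  have h : torus K ◁ patchIncl K i = lift (fst _ _) (snd _ _ ≫ patchIncl K i) := by
    ext1 <;> simp
  have h1 : (torus K ◁ patchIncl K i ≫ act (torus K) (coneSub K)) ≫ coneIncl K =
      (fst _ _ : torus K ⊗ patch K i ⟶ _) • (snd _ _ ≫ patchMap K i) := by
    rw [h, ← patchIncl_comp, ← Category.assoc (snd _ _)]
    exact smul_comp_coneIncl _ _
  rw [h1, Category.assoc, patchIncl_comp]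
  apply hom_ext_cone
  intro k
  rw [comor_smul, comor_patchMap_coord, comor_patchMap_coord, patchAct, comor_comp_map,
    patchCoaction_pcoord, ← comor_lift, lift_fst_snd, Category.id_comp]

lemma patchCoaction_ratio (i : Fin 2) : patchCoaction K i (ratio K i) = 1 ⊗ₜ[K] ratio K i := by
  match i with
  | 0 =>
    have h : ratio K 0 = pmonomial 0 ![1, 6, 0, 0] 4 := by
      simp [ratio, pmonomial, num, denExp, pcoord]
    rw [h, patchCoaction_pmonomial]
    simp [weight, denWeight]
    rfl
  | 1 =>
    have h : ratio K 1 = pmonomial 1 ![0, 2, 0, 9] 5 := by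
      simp [ratio, pmonomial, num, denExp, pcoord]
    rw [h, patchCoaction_pmonomial]
    simp [weight, denWeight]
    rfl

lemma comor_prodToSpec_one_tmul {i : Fin 2} (a : patchRing K i) :
    comor K (prodToSpec K (torusRing K) (patchRing K i)) (1 ⊗ₜ[K] a) =
      comor K (snd (torus K) (patch K i)) a := by
  rw [← prodToSpec_snd, comor_comp_map]
  rfl

lemma patchAct_patchQuot (i : Fin 2) :
    patchAct K i ≫ patchQuot K i = snd _ _ ≫ patchQuot K i := by
  apply hom_ext_polynomial
  rw [comor_patchQuot, comor_patchQuot, patchAct, comor_comp_map, patchCoaction_ratio,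
    comor_prodToSpec_one_tmul]

/-- The products of the torus with the patches cover the source, and on each of them the claim is
the invariance of `ratio`. -/
lemma act_quotientMap : act (torus K) (coneSub K) ≫ quotientMap K = snd _ _ ≫ quotientMap K := by
  refine hom_ext_of_cover (patchIncl K) exists_patchIncl_eq (snd _ _) fun i W k a h => ?_
  have hk : k = lift (k ≫ fst _ _) a ≫ torus K ◁ patchIncl K i := by
    ext1
    · simp
    · simp [h]
  rw [← Category.assoc k (snd _ _), h, hk]
  simp only [Category.assoc]
  rw [reassoc_of% whiskerLeft_patchIncl_act (K := K) i, patchIncl_quotientMap,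
    reassoc_of% patchAct_patchQuot (K := K) i, lift_snd_assoc]

/-! ### Invariant functions -/

lemma pull_quotientMap (i : Fin 2) (e : ⊤ ≤ (patchIncl K i).left ⁻¹ᵁ
      ((quotientMap K).left ⁻¹ᵁ chartOpen K i))
    (e' : ⊤ ≤ (chart K (ne_add_one i)).left ⁻¹ᵁ chartOpen K i)
    (h : Γ((projectiveLine K).left, chartOpen K i)) :
    pull (patchIncl K i).left _ ⊤ e (pull (quotientMap K).left _ _ le_rfl h) =
      pull (patchQuot K i).left ⊤ ⊤ (top_le_preimage_top _) (pull (chart K (ne_add_one i)).left _ ⊤ e' h) := by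
  refine (pull_pull _ _ _ _ _).trans (Eq.trans ?_ (pull_pull _ _ _ _ _).symm)
  exact pull_congr congr(($(patchIncl_quotientMap (K := K) i)).left) _ _ _

/-- In coordinates, pullback along the quotient map is evaluation of polynomials at `ratio`; it is
injective with image the invariants. -/
lemma descendsOver_chartOpen (i : Fin 2) : DescendsOver (act (torus K) (coneSub K)).left
    (snd (torus K) (coneSub K)).left (quotientMap K).left (chartOpen K i) := by
  have e : ⊤ ≤ (patchIncl K i).left ⁻¹ᵁ ((quotientMap K).left ⁻¹ᵁ chartOpen K i) := by
    rw [preimage_chartOpen]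
    exact fun x _ => ⟨x, rfl⟩
  have e' : ⊤ ≤ (chart K (ne_add_one i)).left ⁻¹ᵁ chartOpen K i := by
    intro x _
    change _ ∈ (chartOpen K i : Set (projectiveLine K).left)
    rw [← range_chart K (ne_add_one i)]
    exact ⟨x, rfl⟩
  have hj := pull_bijective (patchIncl K i).left
    (V := (quotientMap K).left ⁻¹ᵁ chartOpen K i) (by rw [preimage_chartOpen]; rfl) e
  have hc := pull_bijective (chart K (ne_add_one i)).left (range_chart K (ne_add_one i)) e'
  have hq (q : Polynomial K) : pull (patchQuot K i).left ⊤ ⊤ (top_le_preimage_top _) (toΓ K _ q) =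
      toΓ K _ (Polynomial.aeval (ratio K i) q) := by
    rw [pull_left_toΓ, patchQuot, comor_affineMap]
  constructor
  · intro h h' hh
    have h1 := congr(pull (patchIncl K i).left _ ⊤ e $hh)
    rw [pull_quotientMap i e e', pull_quotientMap i e e'] at h1
    apply hc.1
    obtain ⟨q, hq1⟩ := (toΓ_bijective K _).2 (pull (chart K (ne_add_one i)).left _ ⊤ e' h)
    obtain ⟨q', hq2⟩ := (toΓ_bijective K _).2 (pull (chart K (ne_add_one i)).left _ ⊤ e' h')
    rw [← hq1, ← hq2, hq, hq] at h1
    rw [← hq1, ← hq2, aeval_ratio_injective i ((toΓ_bijective K _).1 h1)]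
  · intro f hf
    obtain ⟨a, ha⟩ := (toΓ_bijective K _).2 (pull (patchIncl K i).left _ ⊤ e f)
    -- The equalizer condition on the torus times `coneSub`, restricted to the torus times the
    -- patch, is an equation in the tensor product of the coordinate rings.
    have hinv : patchCoaction K i a = 1 ⊗ₜ[K] a := by
      apply comor_injective_of_isIso K (prodToSpec K (torusRing K) (patchRing K i))
      rw [comor_prodToSpec_one_tmul, ← comor_comp_map, ← patchAct, ← pull_left_toΓ,
        ← pull_left_toΓ, ha]
      refine (pull_pull _ _ _ _ _).trans (Eq.trans ?_ (pull_pull _ _ _ _ _).symm)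
      have h1 : (patchAct K i).left ≫ (patchIncl K i).left =
          (torus K ◁ patchIncl K i).left ≫ (act (torus K) (coneSub K)).left :=
        congr(($(whiskerLeft_patchIncl_act (K := K) i)).left).symm
      have h2 : (snd (torus K) (patch K i)).left ≫ (patchIncl K i).left =
          (torus K ◁ patchIncl K i).left ≫ (snd (torus K) (coneSub K)).left :=
        congr(($(whiskerLeft_snd (torus K) (patchIncl K i))).left).symm
      have e₁ : ⊤ ≤ (torus K ◁ patchIncl K i).left ⁻¹ᵁ ((act (torus K) (coneSub K)).left ⁻¹ᵁ
          ((quotientMap K).left ⁻¹ᵁ chartOpen K i)) := by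
        rw [← Scheme.Hom.comp_preimage, ← h1]
        exact fun x _ => e trivial
      have e₂ : ⊤ ≤ (torus K ◁ patchIncl K i).left ⁻¹ᵁ ((snd (torus K) (coneSub K)).left ⁻¹ᵁ
          ((quotientMap K).left ⁻¹ᵁ chartOpen K i)) := by
        rw [← Scheme.Hom.comp_preimage, ← h2]
        exact fun x _ => e trivial
      refine (pull_congr h1 _ e₁ f).trans (Eq.trans ?_ (pull_congr h2 _ e₂ f).symm)
      have h3 := congr(pull (torus K ◁ patchIncl K i).left
        ((act (torus K) (coneSub K)).left ⁻¹ᵁ ((quotientMap K).left ⁻¹ᵁ chartOpen K i) ⊓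
          (snd (torus K) (coneSub K)).left ⁻¹ᵁ ((quotientMap K).left ⁻¹ᵁ chartOpen K i)) ⊤
        (le_inf e₁ e₂) $hf)
      exact (pull_pull _ _ _ _ _).symm.trans (h3.trans (pull_pull _ _ _ _ _))
    obtain ⟨q, hq'⟩ := mem_range_of_invariant hinv
    obtain ⟨h, hh⟩ := hc.2 (toΓ K _ q)
    refine ⟨h, hj.1 ?_⟩
    rw [pull_quotientMap i e e', hh, hq, hq', ha]

variable (K) in
theorem isGoodQuotient_quotientMap : IsGoodQuotient (torus K) (quotientMap K) :=
  isGoodQuotient_of_cover act_quotientMap (chartOpen K) (iSup_chartOpen K)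
    (isAffineOpen_chartOpen K) isAffineOpen_preimage_chartOpen descendsOver_chartOpen

end QuotientMap

end ConeGIT

end

noncomputable section

namespace ConeGIT

/-! ### Orbits on the patches -/

section Orbits

variable {K : Type u} [Field K]

lemma slice_pcoord (i : Fin 2) (k : Fin 4) : slice i (pcoord K i k) =
    ![![Polynomial.X, 1, 1, Polynomial.X], ![1, Polynomial.X, Polynomial.X, 1]] i k := by
  rw [slice, pcoord, patchHom_algebraMap, coneHom_coord]

lemma map_ratio_mul {i : Fin 2} (φ : patchRing K i →ₐ[K] K) {k l : Fin 4}
    (h : den K i = coord K k * coord K l) :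
    φ (ratio K i) * (φ (pcoord K i k) * φ (pcoord K i l)) ^ denExp i =
      φ (algebraMap _ _ (num K i)) := by
  have e : algebraMap _ (patchRing K i) (den K i) = pcoord K i k * pcoord K i l :=
    (congrArg (algebraMap _ (patchRing K i)) h).trans (map_mul _ _ _)
  rw [← ratio_mul, map_mul, map_pow, ← map_mul, ← e]

lemma map_pcoord_ne_zero {i : Fin 2} (φ : patchRing K i →ₐ[K] K) {k l : Fin 4}
    (h : den K i = coord K k * coord K l) : φ (pcoord K i k) ≠ 0 ∧ φ (pcoord K i l) ≠ 0 :=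
  ⟨((isUnit_pcoord h).1.map φ).ne_zero, ((isUnit_pcoord h).2.map φ).ne_zero⟩

lemma map_pcoord_relation {i : Fin 2} (φ : patchRing K i →ₐ[K] K) :
    φ (pcoord K i 0) * φ (pcoord K i 2) = φ (pcoord K i 1) * φ (pcoord K i 3) := by
  rw [← map_mul, pcoord_relation, map_mul]

lemma exists_torus_smul_zero (d : K) (φ : patchRing K 0 →ₐ[K] K) (h : φ (ratio K 0) = d) :
    ∃ t₁ t₂ : Kˣ, ∀ k, torusHom t₁ t₂ (AddMonoidAlgebra.single (weight k) (1 : K)) *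
      (Polynomial.aeval d) (slice 0 (pcoord K 0 k)) = φ (pcoord K 0 k) := by
  obtain ⟨h1, h2⟩ := map_pcoord_ne_zero φ (k := 1) (l := 2) rfl
  have hr := map_ratio_mul φ (k := 1) (l := 2) rfl
  have hrel := map_pcoord_relation φ
  have hn : φ (algebraMap _ _ (num K 0)) = φ (pcoord K 0 0) * φ (pcoord K 0 1) ^ 6 := by
    simp [num, pcoord]
  rw [hn, h, show denExp 0 = 4 from rfl] at hr
  simp_rw [slice_pcoord, torusHom_single]
  -- The solution of t₁t₂² = z₂ and t₁t₂ = z₃; the other two coordinates then follow from the value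
  -- of `ratio` and the relation.
  refine ⟨Units.mk0 (φ (pcoord K 0 2) ^ 2 / φ (pcoord K 0 1)) (div_ne_zero (pow_ne_zero 2 h2) h1),
    Units.mk0 (φ (pcoord K 0 1) / φ (pcoord K 0 2)) (div_ne_zero h1 h2), ?_⟩
  have hz : φ (pcoord K 0 2) ^ 4 * d = φ (pcoord K 0 0) * φ (pcoord K 0 1) ^ 2 :=
    mul_left_cancel₀ (pow_ne_zero 4 h1) (by linear_combination hr)
  intro k
  fin_cases k <;> simp [weight]
  · field_simp
    linear_combination hz
  · field_simp
  · field_simp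
  · field_simp
    linear_combination φ (pcoord K 0 2) * hz + φ (pcoord K 0 1) ^ 2 * hrel

lemma exists_torus_smul_one [IsAlgClosed K] (d : K) (φ : patchRing K 1 →ₐ[K] K)
    (h : φ (ratio K 1) = d ^ 2) :
    ∃ t₁ t₂ : Kˣ, ∀ k, torusHom t₁ t₂ (AddMonoidAlgebra.single (weight k) (1 : K)) *
      (Polynomial.aeval d) (slice 1 (pcoord K 1 k)) = φ (pcoord K 1 k) := by
  obtain ⟨h1, h2⟩ := map_pcoord_ne_zero φ (k := 0) (l := 3) rfl
  have hr := map_ratio_mul φ (k := 0) (l := 3) rfl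
  have hrel := map_pcoord_relation φ
  have hn : φ (algebraMap _ _ (num K 1)) = φ (pcoord K 1 1) ^ 2 * φ (pcoord K 1 3) ^ 9 := by
    simp [num, pcoord]
  rw [hn, h, show denExp 1 = 5 from rfl] at hr
  simp_rw [slice_pcoord, torusHom_single]
  -- The equations t₁² = z₁ and t₁²t₂⁻¹ = z₄ give t₂ = z₁/z₄ and t₁ up to sign; the value of `ratio`
  -- gives the z₂-coordinate up to sign, and the sign of the root `r` is chosen to match it.
  obtain ⟨r, hr1, hr2⟩ : ∃ r : K, r ^ 2 = φ (pcoord K 1 0) ∧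
      r * (φ (pcoord K 1 0) / φ (pcoord K 1 3)) ^ 2 * d = φ (pcoord K 1 1) := by
    obtain ⟨r, hr1⟩ := IsAlgClosed.exists_pow_nat_eq (φ (pcoord K 1 0)) two_pos
    have h3 : (r * (φ (pcoord K 1 0) / φ (pcoord K 1 3)) ^ 2 * d) ^ 2 = φ (pcoord K 1 1) ^ 2 := by
      rw [mul_pow, mul_pow, hr1]
      field_simp
      exact mul_left_cancel₀ (pow_ne_zero 5 h2) (by linear_combination hr)
    rcases sq_eq_sq_iff_eq_or_eq_neg.1 h3 with h4 | h4
    · exact ⟨r, hr1, h4⟩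
    · refine ⟨-r, by rw [neg_sq, hr1], ?_⟩
      rw [neg_mul, neg_mul, h4, neg_neg]
  have hr0 : r ≠ 0 := by
    rintro rfl
    exact h1 (by rw [← hr1, zero_pow two_ne_zero])
  refine ⟨Units.mk0 r hr0, Units.mk0 (φ (pcoord K 1 0) / φ (pcoord K 1 3)) (div_ne_zero h1 h2), ?_⟩
  intro k
  fin_cases k <;> simp [weight]
  · exact hr1
  · exact hr2
  · field_simp
    field_simp at hr2
    exact mul_left_cancel₀ h1 (by linear_combination hr2 - φ (pcoord K 1 3) * hrel)
  · rw [hr1]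
    field_simp

lemma exists_patch_point [IsAlgClosed K] (i : Fin 2) (c : K) :
    ∃ φ₀ : patchRing K i →ₐ[K] K, φ₀ (ratio K i) = c ∧ ∀ φ : patchRing K i →ₐ[K] K,
      φ (ratio K i) = c → ∃ t₁ t₂ : Kˣ, ∀ k,
        torusHom t₁ t₂ (AddMonoidAlgebra.single (weight k) (1 : K)) * φ₀ (pcoord K i k) =
          φ (pcoord K i k) := by
  -- On the slice `ratio` is the power `i + 1` of the parameter, so a root of `c` gives the base
  -- point of the orbit.
  obtain ⟨d, hd⟩ := IsAlgClosed.exists_pow_nat_eq c (Nat.succ_pos i.val)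
  refine ⟨(Polynomial.aeval d).comp (slice i), ?_, fun φ hφ => ?_⟩
  · rw [AlgHom.comp_apply, slice_ratio, map_pow, Polynomial.aeval_X, hd]
  · match i with
    | 0 => exact exists_torus_smul_zero d φ (by rw [hφ, ← hd]; exact pow_one d)
    | 1 => exact exists_torus_smul_one d φ (by rw [hφ, ← hd]; rfl)

end Orbits

/-! ### Fibres of the quotient map -/

section Fibres

variable {K : Type u} [Field K]

lemma range_subset_of_point {X : KScheme K} (x : affineScheme K K ⟶ X) {S : Set X.left}
    {s : (affineScheme K K).left} (hs : x.left s ∈ S) : Set.range x.left ⊆ S := by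
  rintro _ ⟨s', rfl⟩
  have : Subsingleton (affineScheme K K).left := inferInstanceAs (Subsingleton (PrimeSpectrum K))
  rwa [Subsingleton.elim s' s]

lemma smul_quotientMap {W : KScheme K} (g : W ⟶ torus K) (x : W ⟶ coneSub K) :
    (g • x) ≫ quotientMap K = x ≫ quotientMap K := by
  have h := congr(lift g x ≫ $(act_quotientMap (K := K)))
  rw [lift_snd_assoc, ← Category.assoc] at h
  exact h

lemma patch_point_comp_quotientMap {i : Fin 2} (φ : patchRing K i →ₐ[K] K)
    (ψ : Polynomial K →ₐ[K] K) :
    (affineMap K φ ≫ patchIncl K i) ≫ quotientMap K = affineMap K ψ ≫ chart K (ne_add_one i) ↔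
      φ (ratio K i) = ψ Polynomial.X := by
  rw [Category.assoc, patchIncl_quotientMap, ← Category.assoc, cancel_mono, patchQuot,
    affineMap_comp]
  constructor
  · intro h
    simpa using congr($(affineMap_injective K h) Polynomial.X)
  · intro h
    congr 1
    apply Polynomial.algHom_ext
    simpa using h

/-- A point of the projective line lies in some chart, and its whole fibre in the corresponding
patch, so that transitivity on the level sets of `ratio` applies. -/
lemma fibre_eq_orbit_of_spec [IsAlgClosed K] (y : affineScheme K K ⟶ projectiveLine K) :
    ∃ x : affineScheme K K ⟶ coneSub K, ∀ x' : affineScheme K K ⟶ coneSub K,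
      x' ≫ quotientMap K = y ↔ ∃ g : affineScheme K K ⟶ torus K, x' = g • x := by
  let s : (affineScheme K K).left := (⊥ : PrimeSpectrum K)
  obtain ⟨i, hi⟩ : ∃ i, y.left s ∈ chartOpen K i := by
    have h : y.left s ∈ ⨆ i, chartOpen K i := by rw [iSup_chartOpen]; trivial
    exact TopologicalSpace.Opens.mem_iSup.1 h
  have hy : Set.range y.left ⊆ Set.range (chart K (ne_add_one i)).left := by
    rw [range_chart]
    exact range_subset_of_point y hi
  obtain ⟨ψ, hψ⟩ := exists_affineMap_eq K (immersionLift _ y hy)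
  have hψy := immersionLift_comp _ y hy
  rw [hψ] at hψy
  obtain ⟨φ₀, hφ₀, horb⟩ := exists_patch_point i (ψ Polynomial.X)
  refine ⟨affineMap K φ₀ ≫ patchIncl K i, fun x' => ⟨fun hx' => ?_, ?_⟩⟩
  · have hr : Set.range x'.left ⊆ Set.range (patchIncl K i).left := by
      refine range_subset_of_point x' (s := s) ?_
      rw [← quotientMap_mem_chartOpen_iff]
      rw [← hx'] at hi
      exact hi
    obtain ⟨φ, hφ⟩ := exists_affineMap_eq K (immersionLift _ x' hr)
    have hφx := immersionLift_comp _ x' hr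
    rw [hφ] at hφx
    rw [← hψy, ← hφx, patch_point_comp_quotientMap] at hx'
    obtain ⟨t₁, t₂, ht⟩ := horb φ hx'
    refine ⟨affineMap K (torusHom t₁ t₂), ?_⟩
    rw [← cancel_mono (coneIncl K), smul_comp_coneIncl, ← hφx, Category.assoc, Category.assoc,
      patchIncl_comp, patchMap, affineMap_comp, affineMap_comp]
    exact (smul_affineMap_eq _ ht).symm
  · rintro ⟨g, rfl⟩
    rw [smul_quotientMap, ← hψy, patch_point_comp_quotientMap, hφ₀]

variable (K) in
theorem isGeometricQuotient_quotientMap [IsAlgClosed K] :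
    IsGeometricQuotient (torus K) (quotientMap K) where
  toIsGoodQuotient := isGoodQuotient_quotientMap K
  fibre_eq_orbit y := by
    -- Points are parametrized by the monoidal unit in one statement and by `affineScheme K K` in
    -- the other; `e` and `e'` are the mutually inverse identifications.
    let e := toSpec K (𝟙_ (KScheme K))
    let e' := toUnit (affineScheme K K)
    have he : e ≫ e' = 𝟙 _ := toUnit_unique _ _
    have he' : e' ≫ e = 𝟙 _ := hom_toSpec_unique K _ _
    obtain ⟨x, hx⟩ := fibre_eq_orbit_of_spec (e' ≫ y)
    refine ⟨e ≫ x, fun x' => ⟨fun h => ?_, ?_⟩⟩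
    · obtain ⟨g, hg⟩ := (hx (e' ≫ x')).1 (by rw [Category.assoc, h])
      refine ⟨e ≫ g, ?_⟩
      have h1 : x' = e ≫ (g • x) := by rw [← hg, reassoc_of% he]
      rw [h1, ModObj.comp_smul]
      rfl
    · rintro ⟨g, rfl⟩
      have h1 : lift g (e ≫ x) ≫ act (torus K) (coneSub K) = e ≫ ((e' ≫ g) • x) := by
        rw [ModObj.comp_smul, reassoc_of% he]
        rfl
      rw [h1, Category.assoc, smul_quotientMap, (hx x).2 ⟨1, (one_smul _ _).symm⟩,
        reassoc_of% he]

end Fibres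

end ConeGIT

end

theorem proposition3p6 (K : Type u) [Field K] [IsAlgClosed K] [CharZero K] :
    (∃ _ : ModObj (torus K) (openSub (cone K) (coneOpen K)),
      IsModHom (torus K) (openIncl (cone K) (coneOpen K)) ∧
        ∃ (Y : KScheme K) (p : openSub (cone K) (coneOpen K) ⟶ Y),
          IsGeometricQuotient (torus K) p ∧ Nonempty (Y ≅ projectiveLine K)) ∧
    ¬ ∃ L : LinearizedLineBundle (torus K) (cone K),
      L.semistableLocus = (coneOpen K : Set (cone K).left) :=
  ⟨⟨subAction K, coneIncl_isModHom K, projectiveLine K, quotientMap K,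
    isGeometricQuotient_quotientMap K, ⟨Iso.refl _⟩⟩,
    fun ⟨L, hL⟩ => semistableLocus_ne_coneOpen L hL⟩
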